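/- Let $m\ge 2$ be an integer, let $\nu\in\mathbb N_0$ and $n=2\nu+3$. Let $a_1,\dots,a_m$ be real numbers whose squares $a_1^2,\dots,a_m^2$ are pairwise distinct, let $b_0,b_2,\dots,b_{2m}$ be the real numbers with $\sum_{k=0}^m b_{2k}x^{2k}=\prod_{i=1}^m(x^2-a_i^2)$, and let $$P(\partial_x,\partial_t)=\sum_{k=0}^m b_{2k}\,\Delta_n^{m-k}\frac{\partial^{2k}}{\partial t^{2k}},\qquad x\in\mathbb R^n,\ t\in\mathbb R,$$ where $\Delta_n$ is the Laplacian on $\mathbb R^n$. Then for all real- or complex-valued $f\in C^\infty(\mathbb R^n\times\mathbb R)$ and $\varphi_0,\dots,\varphi_{2m-1}\in C^\infty(\mathbb R^n)$ the Cauchy problem $$P(\partial_x,\partial_t)u=f(x,t)\quad(x\in\mathbb R^n,\ t\in\mathbb R),\qquad \frac{\partial^r u}{\partial t^r}\Big|_{t=0}=\varphi_r(x)\quad(r=0,1,\dots,2m-1)$$ has exactly one solution $u\in C^\infty(\mathbb R^n\times\mathbb R)$, and it is given by $$u(x,t)=\int_0^t\!\int_0^{t-\tau}\frac{(t-\tau-\tau')^{2m-3}}{(2m-3)!}\sum_{j=1}^m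 c_j\,\big(B_jf(\cdot,\tau)\big)(x,\tau')\,d\tau'\,d\tau+\sum_{k=1}^m b_{2k}\Delta_n^{m-k}\sum_{r=0}^{2k-1}\frac{\partial^{2k-1-r}}{\partial t^{2k-1-r}}\int_0^t\frac{(t-\tau)^{2m-3}}{(2m-3)!}\sum_{j=1}^m c_j\,(B_j\varphi_r)(x,\tau)\,d\tau .$$ Here $c_j=a_j^{2m-2}\big/\prod_{i\ne j}(a_j^2-a_i^2)$ and, for $g\in C^\infty(\mathbb R^n)$, $$(B_jg)(x,t)=t\,(J^\nu M_j)(t)+\sum_{l=0}^{\nu-1}\frac{a_j^{2l}t^{2l+1}}{(2l+1)!}\Delta_n^l g(x),\qquad (Jh)(t)=\int_0^t h(s)\,s\,ds,$$ where $J^\nu$ is the $\nu$-fold iterate of $J$ (the identity if $\nu=0$) and $$M_j(s)=(a_j^2\Delta_n)^\nu\left[\frac1{S_{n,j}(s)}\int_{|\xi-x|^2=(a_js)^2}g(\xi)\,dS(\xi)\right],\qquad S_{n,j}(s)=2(2\pi)^{\nu+1}(a_js)^{n-1},$$ with $\Delta_n$ acting in $x$ and $dS$ the surface element of the sphere. (If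 $a_j=0$ then $c_j=0$, and the $j$-th term is read as $0$.) -/

import Mathlib

open MeasureTheory Finset
open scoped ContDiff

noncomputable section

namespace HigherOrderCauchy

variable {F : Type*} [NormedAddCommGroup F] [NormedSpace ℝ F] {n : ℕ}

/-- The `k`-th power `Δ_n ^ k` of the Laplacian, acting on functions on `ℝⁿ`. -/
def lapPow (k : ℕ) (g : EuclideanSpace ℝ (Fin n) → F) : EuclideanSpace ℝ (Fin n) → F :=
  (fun h : EuclideanSpace ℝ (Fin n) → F => Laplacian.laplacian h)^[k] g

/-- The operator `P(∂_x, ∂_t) = ∑_{k=0}^m b_{2k} Δ_n^{m-k} ∂_t^{2k}`, applied to `u` at `(x, t)`. -/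
def cauchyOp (m : ℕ) (b : ℕ → ℝ) (u : EuclideanSpace ℝ (Fin n) → ℝ → F)
    (x : EuclideanSpace ℝ (Fin n)) (t : ℝ) : F :=
  ∑ k ∈ range (m + 1),
    b (2 * k) • lapPow (m - k) (fun y => iteratedDeriv (2 * k) (u y) t) x

/-- `u ∈ C^∞(ℝⁿ × ℝ)` solves `P(∂_x, ∂_t) u = f` on `ℝⁿ × ℝ`, with `∂_t^r u = phi_r` at `t = 0` for
`r = 0, …, 2m - 1`. -/
structure IsCauchySolution (m : ℕ) (b : ℕ → ℝ) (f : EuclideanSpace ℝ (Fin n) → ℝ → F)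
    (phi : ℕ → EuclideanSpace ℝ (Fin n) → F) (u : EuclideanSpace ℝ (Fin n) → ℝ → F) : Prop where
  smooth : ContDiff ℝ ∞ (fun p : EuclideanSpace ℝ (Fin n) × ℝ => u p.1 p.2)
  eqn : ∀ x t, cauchyOp m b u x t = f x t
  init : ∀ r < 2 * m, ∀ x, iteratedDeriv r (u x) 0 = phi r x

/-- The surface integral `∫ g dS` over the sphere `{ξ : |ξ - x|² = ρ²}` in `ℝⁿ` (`ρ` may be
negative; its radius is `|ρ|`), parametrized by the unit sphere with its surface measure. -/
def sphereIntegral (g : EuclideanSpace ℝ (Fin n) → F) (x : EuclideanSpace ℝ (Fin n)) (ρ : ℝ) : F :=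
  |ρ| ^ (n - 1) •
    ∫ ζ : Metric.sphere (0 : EuclideanSpace ℝ (Fin n)) 1,
      g (x + |ρ| • (ζ : EuclideanSpace ℝ (Fin n)))
      ∂((volume : Measure (EuclideanSpace ℝ (Fin n))).toSphere)

/-- The normalization `S = 2 (2π)^{ν+1} ρ^{n-1}`. -/
def sphereNorm (n ν : ℕ) (ρ : ℝ) : ℝ := 2 * (2 * Real.pi) ^ (ν + 1) * ρ ^ (n - 1)

/-- The operation `h ↦ (t ↦ ∫_0^t h(s) s ds)`. -/
def weightedPrimitive (h : ℝ → F) (t : ℝ) : F := ∫ s in (0 : ℝ)..t, s • h s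

/-- The bracket
`t ∫_0^t t dt ⋯ ∫_0^t ((a² Δ_n)^ν / S) ∫_S g(ξ) dS t dt + ∑_{l<ν} a^{2l} t^{2l+1} / (2l+1)! Δ_n^l g(x)`
with `ν` iterated integrals, where `S` is the sphere about `x` of radius `|a t|`, and the symbol `S`
in the denominator is `2 (2π)^{ν+1} (a t)^{n-1}`. -/
def bracket (ν : ℕ) (a : ℝ) (g : EuclideanSpace ℝ (Fin n) → F)
    (x : EuclideanSpace ℝ (Fin n)) (t : ℝ) : F :=
  t • (weightedPrimitive^[ν] (fun s : ℝ =>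
        (a ^ 2) ^ ν •
          lapPow ν (fun y => (sphereNorm n ν (a * s))⁻¹ • sphereIntegral g y (a * s)) x) : ℝ → F) t
    + ∑ l ∈ range ν, (a ^ (2 * l) * t ^ (2 * l + 1) / ((2 * l + 1).factorial : ℝ)) • lapPow l g x

/-- The sum `∑_j a_j^{2m-2} / ∏_{i≠j} (a_j² - a_i²) [bracket for a_j]`. -/
def bracketSum (m ν : ℕ) (a : Fin m → ℝ) (g : EuclideanSpace ℝ (Fin n) → F)
    (x : EuclideanSpace ℝ (Fin n)) (t : ℝ) : F :=
  ∑ j : Fin m, (a j ^ (2 * m - 2) / ∏ i ∈ univ.erase j, (a j ^ 2 - a i ^ 2)) • bracket ν (a j) g x t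

/-- The explicit expression for the solution. -/
def explicitSolution (m ν : ℕ) (a : Fin m → ℝ) (b : ℕ → ℝ)
    (f : EuclideanSpace ℝ (Fin n) → ℝ → F) (phi : ℕ → EuclideanSpace ℝ (Fin n) → F)
    (x : EuclideanSpace ℝ (Fin n)) (t : ℝ) : F :=
  (∫ τ in (0 : ℝ)..t, ∫ τ' in (0 : ℝ)..(t - τ),
      ((t - τ - τ') ^ (2 * m - 3) / ((2 * m - 3).factorial : ℝ)) •
        bracketSum m ν a (fun ξ => f ξ τ) x τ')
  + ∑ k ∈ Icc 1 m, b (2 * k) • lapPow (m - k) (fun y =>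
      ∑ r ∈ range (2 * k), iteratedDeriv (2 * k - 1 - r) (fun t' : ℝ =>
        ∫ τ in (0 : ℝ)..t', ((t' - τ) ^ (2 * m - 3) / ((2 * m - 3).factorial : ℝ)) •
          bracketSum m ν a (phi r) y τ) t) x

end HigherOrderCauchy

end

noncomputable section

namespace HigherOrderCauchy

/-! ### Differentiation under integrals over finite measures carried by a compact set -/

section ParametricIntegral

universe u

/-! The operator factors as `P = ∏ (∂_t² - a_i² Δ)`, so everything is built from waves of speed
`a_j`. Let `w_j g` (`waveOp`) be the wave with data `0, g`. Then `∂_t^{2k} w_j g = a_j^{2k} w_j (Δ^k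
g)`, and `P (w_j g) = (∑ b_{2k} a_j^{2k}) w_j (Δ^m g) = 0`, because `a_j` is a root of the symbol.

Spherical means give `w_j`. By Darboux's equation (`darboux`) they satisfy `t h'' + (n-1) h' = t q`,
where `q` is `a_j²` times the same mean of `Δ g`. Each weighted primitive `J` lowers the coefficient
of `h'` by 2 (`weightedPrimitive_epd`). As `n - 1 = 2(ν+1)`, after `ν` steps the left side is `t h''
+ 2 h' = (t h)''`. The only defect is a monomial left by the value of the mean at `0`, and the
Taylor polynomial in the bracket cancels it (`deriv_deriv_waveOp`).

The propagator `W g` is the `(2m-2)`-fold primitive of `∑ c_j w_j g`. Hence `∂_t^{2m-2} P W g = 0`,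
so `P W g` is a polynomial in `t`, and its Taylor coefficients at `0` vanish as well
(`cauchyOp_propagator`). Lagrange's identities for `∑_j y_j^i / ∏ (y_j - y_k)` at the nodes `y_j =
a_j²` show that `W g` has data `0, …, 0, g`.

Any such `W` settles the Cauchy problem. Existence is Duhamel's integral plus a combination of time
derivatives of `W (Δ^{m-k} φ_r)`. For uniqueness, the data of a solution `u` at time `s` are
propagated up to time `t`. The `s`-derivative of the result telescopes to `W (f(s)) (t-s)`, and
integration over `[0, t]` expresses `u` by the formula, without an energy estimate
(`IsPropagator.eq_of_isCauchySolution`).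

All interchanges of `W` with `Δ`, time derivatives and integrals come from the predicate `SmoothOp`,
which is closed under the constructions used here. -/

theorem integrable_of_continuous_of_ae_mem_compact {G : Type*} [NormedAddCommGroup G]
    {V : Type*} [NormedAddCommGroup V] [SecondCountableTopology V] [MeasurableSpace V]
    [BorelSpace V] (μ : Measure V) [IsFiniteMeasure μ] {K : Set V}
    (hK : IsCompact K) (hμ : ∀ᵐ v ∂μ, v ∈ K) {H : V → G} (hH : Continuous H) :
    Integrable H μ := by
  obtain ⟨C, hC⟩ := hK.exists_bound_of_continuousOn hH.continuousOn
  exact Integrable.of_bound hH.aestronglyMeasurable C (hμ.mono fun v hv => hC v hv)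

theorem fderiv_partial_left {X V G : Type*} [NormedAddCommGroup X] [NormedSpace ℝ X]
    [NormedAddCommGroup V] [NormedSpace ℝ V] [NormedAddCommGroup G] [NormedSpace ℝ G]
    {H : X × V → G} (hH : ContDiff ℝ ∞ H) (x : X) (v : V) :
    HasFDerivAt (fun y => H (y, v)) ((fderiv ℝ H (x, v)).comp (ContinuousLinearMap.inl ℝ X V)) x :=
    by
  have h1 := (hH.differentiable (by simp) (x, v)).hasFDerivAt
  exact h1.comp x (hasFDerivAt_prodMk_left x v)

variable {X : Type} [NormedAddCommGroup X] [NormedSpace ℝ X] [FiniteDimensional ℝ X]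
  {V : Type} [NormedAddCommGroup V] [NormedSpace ℝ V] [SecondCountableTopology V]
  [MeasurableSpace V] [BorelSpace V]

theorem hasFDerivAt_integral_param {G : Type u} [NormedAddCommGroup G] [NormedSpace ℝ G]
    (μ : Measure V) [IsFiniteMeasure μ] {K : Set V} (hK : IsCompact K) (hμ : ∀ᵐ v ∂μ, v ∈ K)
    {H : X × V → G} (hH : ContDiff ℝ ∞ H) (x : X) :
    HasFDerivAt (fun y => ∫ v, H (y, v) ∂μ)
      (∫ v, (fderiv ℝ H (x, v)).comp (ContinuousLinearMap.inl ℝ X V) ∂μ) x := by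
  have hc : Continuous fun p : X × V => (fderiv ℝ H p).comp (ContinuousLinearMap.inl ℝ X V) :=
    ((hH.continuous_fderiv (by simp)).clm_comp continuous_const)
  -- Compactness of the unit ball about `x` times `K` gives a constant dominating function.
  obtain ⟨C, hC⟩ := ((isCompact_closedBall x 1).prod hK).exists_bound_of_continuousOn
    hc.continuousOn
  refine hasFDerivAt_integral_of_dominated_of_fderiv_le (bound := fun _ => C)
    (F' := fun y v => (fderiv ℝ H (y, v)).comp (ContinuousLinearMap.inl ℝ X V))
    (Metric.closedBall_mem_nhds x one_pos) ?_ ?_ ?_ ?_ ?_ ?_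
  · exact Filter.Eventually.of_forall fun y =>
      (hH.continuous.comp (by fun_prop : Continuous fun v => (y, v))).aestronglyMeasurable
  · exact integrable_of_continuous_of_ae_mem_compact μ hK hμ
      (hH.continuous.comp (by fun_prop : Continuous fun v => (x, v)))
  · exact (hc.comp (by fun_prop : Continuous fun v => (x, v))).aestronglyMeasurable
  · exact hμ.mono fun v hv y hy => hC (y, v) ⟨hy, hv⟩
  · exact integrable_const C
  · exact Filter.Eventually.of_forall fun v y _ => fderiv_partial_left hH y v

/-- The derivative is again an integral of the same kind with values in `X →L[ℝ] G`, so the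
induction varies `G`. This needs `X : Type`, which keeps `X →L[ℝ] G` in the universe of `G`. -/
theorem contDiff_integral_param {G : Type u} [NormedAddCommGroup G] [NormedSpace ℝ G]
    (μ : Measure V) [IsFiniteMeasure μ] {K : Set V} (hK : IsCompact K) (hμ : ∀ᵐ v ∂μ, v ∈ K)
    {H : X × V → G} (hH : ContDiff ℝ ∞ H) :
    ContDiff ℝ ∞ (fun x => ∫ v, H (x, v) ∂μ) := by
  rw [contDiff_infty]
  intro k
  induction k generalizing G with
  | zero =>
    exact contDiff_zero.2 (continuous_iff_continuousAt.2 fun x =>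
      (hasFDerivAt_integral_param μ hK hμ hH x).continuousAt)
  | succ k ih =>
    push_cast
    rw [contDiff_succ_iff_fderiv]
    refine ⟨fun x => (hasFDerivAt_integral_param μ hK hμ hH x).differentiableAt, by simp, ?_⟩
    rw [show fderiv ℝ (fun x => ∫ v, H (x, v) ∂μ) = _ from
      funext fun x => (hasFDerivAt_integral_param μ hK hμ hH x).fderiv]
    refine ih (H := fun p => (fderiv ℝ H p).comp (ContinuousLinearMap.inl ℝ X V)) ?_
    exact (hH.fderiv_right (by simp)).clm_comp contDiff_const

/-- Differentiating under the integral along a direction. -/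
theorem fderiv_integral_param_apply {G : Type u} [NormedAddCommGroup G] [NormedSpace ℝ G]
    [CompleteSpace G]
    (μ : Measure V) [IsFiniteMeasure μ] {K : Set V} (hK : IsCompact K) (hμ : ∀ᵐ v ∂μ, v ∈ K)
    {H : X × V → G} (hH : ContDiff ℝ ∞ H) (x e : X) :
    fderiv ℝ (fun y => ∫ v, H (y, v) ∂μ) x e = ∫ v, fderiv ℝ (fun y => H (y, v)) x e ∂μ := by
  have hc : Continuous fun v : V =>
      (fderiv ℝ H (x, v)).comp (ContinuousLinearMap.inl ℝ X V) :=
    ((hH.continuous_fderiv (by simp)).clm_comp continuous_const).comp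
      (by fun_prop : Continuous fun v => (x, v))
  rw [(hasFDerivAt_integral_param μ hK hμ hH x).fderiv,
    ContinuousLinearMap.integral_apply (integrable_of_continuous_of_ae_mem_compact μ hK hμ hc)]
  exact integral_congr_ae (Filter.Eventually.of_forall fun v => by
    simp only [(fderiv_partial_left hH x v).fderiv])

theorem deriv_integral_param {G : Type u} [NormedAddCommGroup G] [NormedSpace ℝ G]
    [CompleteSpace G]
    (μ : Measure V) [IsFiniteMeasure μ] {K : Set V} (hK : IsCompact K) (hμ : ∀ᵐ v ∂μ, v ∈ K)
    {H : ℝ × V → G} (hH : ContDiff ℝ ∞ H) (s : ℝ) :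
    deriv (fun y => ∫ v, H (y, v) ∂μ) s = ∫ v, deriv (fun y => H (y, v)) s ∂μ := by
  simp only [← fderiv_apply_one_eq_deriv]
  exact fderiv_integral_param_apply μ hK hμ hH s 1

end ParametricIntegral

/-! ### Interval integrals with parameters -/

section IntervalIntegral

variable {X : Type} [NormedAddCommGroup X] [NormedSpace ℝ X] [FiniteDimensional ℝ X]
  {G : Type*} [NormedAddCommGroup G] [NormedSpace ℝ G]

/-- Rescaling to the unit interval turns the endpoint into an ordinary parameter, also for negative
`t`, so the results for a fixed finite measure apply. -/
theorem integral_zero_eq_smul_integral_Ioc (h : ℝ → G) (t : ℝ) :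
    ∫ s in (0 : ℝ)..t, h s = t • ∫ θ in Set.Ioc (0 : ℝ) 1, h (t * θ) := by
  rw [← intervalIntegral.integral_of_le zero_le_one, intervalIntegral.smul_integral_comp_mul_left]
  simp

theorem ae_mem_Icc_of_restrict_Ioc :
    ∀ᵐ θ ∂(volume.restrict (Set.Ioc (0 : ℝ) 1)), θ ∈ Set.Icc (0 : ℝ) 1 :=
  (ae_restrict_mem measurableSet_Ioc).mono fun _ h => Set.Ioc_subset_Icc_self h

theorem contDiff_integral_upper {H : X × ℝ → G} (hH : ContDiff ℝ ∞ H) {τ : X → ℝ}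
    (hτ : ContDiff ℝ ∞ τ) : ContDiff ℝ ∞ (fun x => ∫ s in (0 : ℝ)..τ x, H (x, s)) := by
  simp only [integral_zero_eq_smul_integral_Ioc]
  refine hτ.smul (contDiff_integral_param (V := ℝ) (volume.restrict (Set.Ioc (0 : ℝ) 1))
    isCompact_Icc ae_mem_Icc_of_restrict_Ioc (H := fun p : X × ℝ => H (p.1, τ p.1 * p.2)) ?_)
  fun_prop

theorem fderiv_intervalIntegral_apply [CompleteSpace G] {H : X × ℝ → G} (hH : ContDiff ℝ ∞ H)
    (t : ℝ) (x e : X) :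
    fderiv ℝ (fun y => ∫ s in (0 : ℝ)..t, H (y, s)) x e =
      ∫ s in (0 : ℝ)..t, fderiv ℝ (fun y => H (y, s)) x e := by
  simp only [integral_zero_eq_smul_integral_Ioc]
  have hH' : ContDiff ℝ ∞ (fun p : X × ℝ => H (p.1, t * p.2)) := by fun_prop
  rw [fderiv_fun_const_smul, _root_.smul_apply]
  · congr 1
    exact fderiv_integral_param_apply (volume.restrict (Set.Ioc (0 : ℝ) 1))
      isCompact_Icc ae_mem_Icc_of_restrict_Ioc hH' x e
  · exact ((contDiff_integral_param (volume.restrict (Set.Ioc (0 : ℝ) 1))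
      isCompact_Icc ae_mem_Icc_of_restrict_Ioc hH').differentiable (by simp)) x

theorem deriv_intervalIntegral_param [CompleteSpace G] {H : ℝ × ℝ → G} (hH : ContDiff ℝ ∞ H)
    (t s : ℝ) :
    deriv (fun y => ∫ τ in (0 : ℝ)..t, H (y, τ)) s =
      ∫ τ in (0 : ℝ)..t, deriv (fun y => H (y, τ)) s := by
  simp only [← fderiv_apply_one_eq_deriv]
  exact fderiv_intervalIntegral_apply hH t s 1

end IntervalIntegral

/-! ### Partial derivatives in two real variables -/

section Partial

variable {G : Type*} [NormedAddCommGroup G] [NormedSpace ℝ G]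

theorem deriv_partial_fst {H : ℝ × ℝ → G} (hH : ContDiff ℝ ∞ H) (s t : ℝ) :
    deriv (fun s => H (s, t)) s = fderiv ℝ H (s, t) (1, 0) := by
  have h := (hH.differentiable (by simp) (s, t)).hasFDerivAt.comp_hasDerivAt s
    ((hasDerivAt_id s).prodMk (hasDerivAt_const s t))
  exact h.deriv

theorem deriv_partial_snd {H : ℝ × ℝ → G} (hH : ContDiff ℝ ∞ H) (s t : ℝ) :
    deriv (fun t => H (s, t)) t = fderiv ℝ H (s, t) (0, 1) := by
  have h := (hH.differentiable (by simp) (s, t)).hasFDerivAt.comp_hasDerivAt t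
    ((hasDerivAt_const t s).prodMk (hasDerivAt_id t))
  exact h.deriv

theorem fderiv_fderiv_apply_comm {Z : Type*} [NormedAddCommGroup Z] [NormedSpace ℝ Z]
    {H : Z → G} (hH : ContDiff ℝ ∞ H) (z u v : Z) :
    fderiv ℝ (fun w => fderiv ℝ H w u) z v = fderiv ℝ (fun w => fderiv ℝ H w v) z u := by
  have hd : DifferentiableAt ℝ (fderiv ℝ H) z :=
    (hH.fderiv_right (m := ∞) (by simp)).differentiable (by simp) z
  have key : ∀ a b : Z, fderiv ℝ (fun w => fderiv ℝ H w a) z b = fderiv ℝ (fderiv ℝ H) z b a := by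
    intro a b
    rw [fderiv_clm_apply hd (differentiableAt_const a)]
    simp
  rw [key, key]
  have h2 : (2 : WithTop ℕ∞) ≤ ∞ := by exact WithTop.coe_le_coe.2 (le_top (a := (2 : ℕ∞)))
  exact (hH.contDiffAt.isSymmSndFDerivAt (by simpa using h2)).eq v u

theorem deriv_deriv_comm {H : ℝ × ℝ → G} (hH : ContDiff ℝ ∞ H) (s t : ℝ) :
    deriv (fun t => deriv (fun s => H (s, t)) s) t =
      deriv (fun s => deriv (fun t => H (s, t)) t) s := by
  simp only [deriv_partial_fst hH, deriv_partial_snd hH]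
  have h1 : ContDiff ℝ ∞ (fun w => fderiv ℝ H w ((1 : ℝ), (0 : ℝ))) :=
    (hH.fderiv_right (by simp)).clm_apply contDiff_const
  have h2 : ContDiff ℝ ∞ (fun w => fderiv ℝ H w ((0 : ℝ), (1 : ℝ))) :=
    (hH.fderiv_right (by simp)).clm_apply contDiff_const
  rw [deriv_partial_snd h1, deriv_partial_fst h2, fderiv_fderiv_apply_comm hH]

theorem hasDerivAt_diag {H : ℝ × ℝ → G} (hH : ContDiff ℝ ∞ H) {p q : ℝ → ℝ} {p' q' t : ℝ}
    (hp : HasDerivAt p p' t) (hq : HasDerivAt q q' t) :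
    HasDerivAt (fun t => H (p t, q t))
      (p' • deriv (fun s => H (s, q t)) (p t) + q' • deriv (fun s => H (p t, s)) (q t)) t := by
  have h := (hH.differentiable (by simp) (p t, q t)).hasFDerivAt.comp_hasDerivAt t (hp.prodMk hq)
  refine h.congr_deriv ?_
  rw [deriv_partial_fst hH, deriv_partial_snd hH, ← map_smul, ← map_smul, ← map_add]
  simp

/-- The two occurrences of `t` are separated into the variables of `K`, and the chain rule is
applied along the diagonal. -/
theorem deriv_integral_conv [CompleteSpace G] {H : ℝ × ℝ → G} (hH : ContDiff ℝ ∞ H) (t : ℝ) :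
    deriv (fun t => ∫ τ in (0 : ℝ)..t, H (τ, t - τ)) t =
      H (t, 0) + ∫ τ in (0 : ℝ)..t, deriv (fun s => H (τ, s)) (t - τ) := by
  set K : ℝ × ℝ → G := fun p => ∫ τ in (0 : ℝ)..p.1, H (τ, p.2 - τ) with hK
  have hH' : ContDiff ℝ ∞ (fun p : (ℝ × ℝ) × ℝ => H (p.2, p.1.2 - p.2)) := by fun_prop
  have hKs : ContDiff ℝ ∞ K := contDiff_integral_upper hH' contDiff_fst
  have h := (hasDerivAt_diag hKs (hasDerivAt_id t) (hasDerivAt_id t)).deriv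
  simp only [one_smul, id] at h
  refine h.trans ?_
  congr 1
  · have hc : Continuous fun τ => H (τ, t - τ) := hH.continuous.comp (by fun_prop)
    have := (intervalIntegral.integral_hasDerivAt_right (hc.intervalIntegrable 0 t)
      hc.stronglyMeasurable.stronglyMeasurableAtFilter hc.continuousAt).deriv
    simpa [hK] using this
  · have h2 : ContDiff ℝ ∞ (fun p : ℝ × ℝ => H (p.2, p.1 - p.2)) := by fun_prop
    rw [hK, deriv_intervalIntegral_param h2]
    refine intervalIntegral.integral_congr fun τ _ => ?_
    exact deriv_comp_sub_const (f := fun s => H (τ, s)) τ t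

end Partial

/-! ### Translation-invariant operators with smooth parameter dependence -/

section SmoothOp

variable {E : Type} [NormedAddCommGroup E] [NormedSpace ℝ E]
  {F : Type*} [NormedAddCommGroup F] [NormedSpace ℝ F]

/-- A linear operator taking a function `g` on `E` to a function on `E × ℝ` which preserves smooth
dependence on a parameter, commutes with differentiation in that parameter, and commutes with
translations of `E`. -/
structure SmoothOp (T : (E → F) → E → ℝ → F) : Prop where
  smooth : ∀ G : E → ℝ → F, ContDiff ℝ ∞ (fun p : E × ℝ => G p.1 p.2) →
    ContDiff ℝ ∞ (fun p : E × ℝ × ℝ => T (fun y => G y p.2.1) p.1 p.2.2)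
  deriv_comm : ∀ G : E → ℝ → F, ContDiff ℝ ∞ (fun p : E × ℝ => G p.1 p.2) → ∀ s x t,
    T (fun y => deriv (G y) s) x t = deriv (fun s => T (fun y => G y s) x t) s
  translate : ∀ g : E → F, ContDiff ℝ ∞ g → ∀ e x t, T (fun y => g (y + e)) x t = T g (x + e) t
  add : ∀ g h : E → F, ContDiff ℝ ∞ g → ContDiff ℝ ∞ h → ∀ x t,
    T (fun y => g y + h y) x t = T g x t + T h x t
  smul : ∀ (c : ℝ) (g : E → F), ContDiff ℝ ∞ g → ∀ x t, T (fun y => c • g y) x t = c • T g x t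

theorem contDiff_slice {G : E → ℝ → F} (hG : ContDiff ℝ ∞ (fun p : E × ℝ => G p.1 p.2)) (s : ℝ) :
    ContDiff ℝ ∞ (fun y => G y s) :=
  hG.comp (f := fun y : E => (y, s)) (by fun_prop)

theorem contDiff_slice_right {G : E → ℝ → F} (hG : ContDiff ℝ ∞ (fun p : E × ℝ => G p.1 p.2))
    (y : E) : ContDiff ℝ ∞ (G y) :=
  hG.comp (f := fun s : ℝ => (y, s)) (by fun_prop)

theorem deriv_eq_fderiv_uncurry {G : E → ℝ → F} (hG : ContDiff ℝ ∞ (fun p : E × ℝ => G p.1 p.2))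
    (y : E) (s : ℝ) : deriv (G y) s = fderiv ℝ (fun p : E × ℝ => G p.1 p.2) (y, s) (0, 1) :=
  ((hG.differentiable (by simp) (y, s)).hasFDerivAt.comp_hasDerivAt s
    ((hasDerivAt_const s y).prodMk (hasDerivAt_id s))).deriv

theorem fderiv_eq_fderiv_uncurry {G : E → ℝ → F} (hG : ContDiff ℝ ∞ (fun p : E × ℝ => G p.1 p.2))
    (e y : E) (s : ℝ) :
    fderiv ℝ (fun z => G z s) y e = fderiv ℝ (fun p : E × ℝ => G p.1 p.2) (y, s) (e, 0) := by
  rw [(fderiv_partial_left hG y s).fderiv]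
  rfl

theorem contDiff_deriv_uncurry {G : E → ℝ → F} (hG : ContDiff ℝ ∞ (fun p : E × ℝ => G p.1 p.2)) :
    ContDiff ℝ ∞ (fun p : E × ℝ => deriv (G p.1) p.2) := by
  simp only [deriv_eq_fderiv_uncurry hG]
  exact (hG.fderiv_right (by simp)).clm_apply contDiff_const

theorem contDiff_fderiv_uncurry {G : E → ℝ → F} (hG : ContDiff ℝ ∞ (fun p : E × ℝ => G p.1 p.2))
    (e : E) : ContDiff ℝ ∞ (fun p : E × ℝ => fderiv ℝ (fun z => G z p.2) p.1 e) := by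
  simp only [fderiv_eq_fderiv_uncurry hG]
  exact (hG.fderiv_right (by simp)).clm_apply contDiff_const

theorem fderiv_deriv_comm {G : E → ℝ → F} (hG : ContDiff ℝ ∞ (fun p : E × ℝ => G p.1 p.2))
    (e y : E) (s : ℝ) :
    fderiv ℝ (fun z => deriv (G z) s) y e = deriv (fun s => fderiv ℝ (fun z => G z s) y e) s := by
  rw [fderiv_eq_fderiv_uncurry (contDiff_deriv_uncurry hG),
    deriv_eq_fderiv_uncurry (G := fun y s => fderiv ℝ (fun z => G z s) y e)
      (contDiff_fderiv_uncurry hG e)]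
  simp only [deriv_eq_fderiv_uncurry hG, fderiv_eq_fderiv_uncurry hG]
  exact fderiv_fderiv_apply_comm hG _ _ _

theorem contDiff_iteratedDeriv_uncurry {G : E → ℝ → F}
    (hG : ContDiff ℝ ∞ (fun p : E × ℝ => G p.1 p.2)) (k : ℕ) :
    ContDiff ℝ ∞ (fun p : E × ℝ => iteratedDeriv k (G p.1) p.2) := by
  induction k with
  | zero => simpa using hG
  | succ k ih =>
    simp only [iteratedDeriv_succ]
    exact contDiff_deriv_uncurry (G := fun y s => iteratedDeriv k (G y) s) ih

namespace SmoothOp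

variable {T T' : (E → F) → E → ℝ → F}

theorem contDiff (hT : SmoothOp T) {g : E → F} (hg : ContDiff ℝ ∞ g) :
    ContDiff ℝ ∞ (fun p : E × ℝ => T g p.1 p.2) :=
  (hT.smooth (fun y _ => g y) (hg.comp contDiff_fst)).comp
    (f := fun p : E × ℝ => (p.1, (0 : ℝ), p.2)) (by fun_prop)

theorem contDiff_right (hT : SmoothOp T) {g : E → F} (hg : ContDiff ℝ ∞ g) (x : E) :
    ContDiff ℝ ∞ (T g x) :=
  contDiff_slice_right (hT.contDiff hg) x

theorem contDiff_param (hT : SmoothOp T) {G : E → ℝ → F}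
    (hG : ContDiff ℝ ∞ (fun p : E × ℝ => G p.1 p.2)) (x : E) :
    ContDiff ℝ ∞ (fun p : ℝ × ℝ => T (fun y => G y p.1) x p.2) :=
  (hT.smooth G hG).comp (f := fun p : ℝ × ℝ => (x, p.1, p.2)) (by fun_prop)

/-- Agreement on smooth functions suffices. This is needed because identities such as the one
between brackets and waves are only available for smooth data. -/
theorem congr (hT : SmoothOp T) (h : ∀ g, ContDiff ℝ ∞ g → ∀ x t, T' g x t = T g x t) :
    SmoothOp T' where
  smooth G hG := by
    simp only [h _ (contDiff_slice hG _)]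
    exact hT.smooth G hG
  deriv_comm G hG s x t := by
    rw [h _ (contDiff_slice (contDiff_deriv_uncurry hG) s), hT.deriv_comm G hG]
    simp only [h _ (contDiff_slice hG _)]
  translate g hg e x t := by
    rw [h g hg, h _ (by fun_prop), hT.translate g hg]
  add g k hg hk x t := by
    rw [h g hg, h k hk, h _ (hg.add hk), hT.add g k hg hk]
  smul c g hg x t := by
    rw [h g hg, h _ (hg.const_smul c), hT.smul c g hg]

theorem const : SmoothOp (fun (g : E → F) x (_ : ℝ) => g x) where
  smooth G hG := hG.comp (f := fun p : E × ℝ × ℝ => (p.1, p.2.1)) (by fun_prop)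
  deriv_comm _ _ _ _ _ := rfl
  translate _ _ _ _ _ := rfl
  add _ _ _ _ _ _ := rfl
  smul _ _ _ _ _ := rfl

theorem comp_mul (hT : SmoothOp T) (a : ℝ) : SmoothOp (fun g x t => T g x (a * t)) where
  smooth G hG := (hT.smooth G hG).comp (f := fun p : E × ℝ × ℝ => (p.1, p.2.1, a * p.2.2))
    (by fun_prop)
  deriv_comm G hG s x t := hT.deriv_comm G hG s x _
  translate g hg e x t := hT.translate g hg e x _
  add g h hg hh x t := hT.add g h hg hh x _
  smul c g hg x t := hT.smul c g hg x _

theorem smul_fun (hT : SmoothOp T) {c : ℝ → ℝ} (hc : ContDiff ℝ ∞ c) :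
    SmoothOp (fun g x t => c t • T g x t) where
  smooth G hG := (hc.comp (f := fun p : E × ℝ × ℝ => p.2.2) (by fun_prop)).smul (hT.smooth G hG)
  deriv_comm G hG s x t := by
    rw [hT.deriv_comm G hG, deriv_fun_const_smul_field]
  translate g hg e x t := by rw [hT.translate g hg]
  add g h hg hh x t := by rw [hT.add g h hg hh, smul_add]
  smul c' g hg x t := by rw [hT.smul c' g hg, smul_comm]

theorem const_smul (hT : SmoothOp T) (c : ℝ) : SmoothOp (fun g x t => c • T g x t) :=
  hT.smul_fun contDiff_const

theorem fun_add (hT : SmoothOp T) (hT' : SmoothOp T') :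
    SmoothOp (fun g x t => T g x t + T' g x t) where
  smooth G hG := (hT.smooth G hG).add (hT'.smooth G hG)
  deriv_comm G hG s x t := by
    rw [hT.deriv_comm G hG, hT'.deriv_comm G hG, deriv_fun_add]
    · exact ((hT.contDiff_param hG x).comp (f := fun s : ℝ => (s, t)) (by fun_prop)).differentiable
        (by simp) s
    · exact ((hT'.contDiff_param hG x).comp (f := fun s : ℝ => (s, t)) (by fun_prop)).differentiable
        (by simp) s
  translate g hg e x t := by rw [hT.translate g hg, hT'.translate g hg]
  add g h hg hh x t := by rw [hT.add g h hg hh, hT'.add g h hg hh]; abel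
  smul c g hg x t := by rw [hT.smul c g hg, hT'.smul c g hg, smul_add]

theorem sum {ι : Type*} (s : Finset ι) {T : ι → (E → F) → E → ℝ → F}
    (hT : ∀ i ∈ s, SmoothOp (T i)) : SmoothOp (fun g x t => ∑ i ∈ s, T i g x t) := by
  classical
  induction s using Finset.induction_on with
  | empty =>
    exact (const.const_smul (0 : ℝ)).congr fun g _ x t => by simp
  | insert i s hi ih =>
    refine ((hT i (mem_insert_self i s)).fun_add
      (ih fun j hj => hT j (mem_insert_of_mem hj))).congr fun g _ x t => ?_
    rw [sum_insert hi]

theorem map_sum (hT : SmoothOp T) {ι : Type*} (s : Finset ι) (g : ι → E → F)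
    (hg : ∀ i ∈ s, ContDiff ℝ ∞ (g i)) (x : E) (t : ℝ) :
    T (fun y => ∑ i ∈ s, g i y) x t = ∑ i ∈ s, T (g i) x t := by
  classical
  induction s using Finset.induction_on with
  | empty =>
    have := hT.smul 0 (fun _ => 0) contDiff_const x t
    simpa using this
  | insert i s hi ih =>
    have h' : ∀ j ∈ s, ContDiff ℝ ∞ (g j) := fun j hj => hg j (mem_insert_of_mem hj)
    simp only [sum_insert hi]
    rw [hT.add (g i) _ (hg i (mem_insert_self i s)) (ContDiff.sum h'), ih h']

/-- Such operators commute with directional derivatives. -/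
theorem fderiv_comm (hT : SmoothOp T) {g : E → F} (hg : ContDiff ℝ ∞ g) (e x : E) (t : ℝ) :
    T (fun y => fderiv ℝ g y e) x t = fderiv ℝ (fun y => T g y t) x e := by
  -- A directional derivative is the parameter derivative of a family of translates, so `deriv_comm`
  -- and `translate` together yield the claim.
  have key : ∀ {h : E → F}, ContDiff ℝ ∞ h → ∀ y,
      fderiv ℝ h y e = deriv (fun s : ℝ => h (y + s • e)) 0 := by
    intro h hh y
    have h1 : HasDerivAt (fun s : ℝ => y + s • e) e 0 := by
      simpa using ((hasDerivAt_id (0 : ℝ)).smul_const e).const_add y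
    have h2 : HasFDerivAt h (fderiv ℝ h y) (y + (0 : ℝ) • e) := by
      simpa using (hh.differentiable (by simp) y).hasFDerivAt
    exact (h2.comp_hasDerivAt (0 : ℝ) h1).deriv.symm
  have hG : ContDiff ℝ ∞ (fun p : E × ℝ => g (p.1 + p.2 • e)) := by fun_prop
  rw [key (contDiff_slice (hT.contDiff hg) t) x]
  simp only [key hg]
  rw [hT.deriv_comm (fun y s => g (y + s • e)) hG]
  simp only [hT.translate g hg]

theorem comp_fderiv (hT : SmoothOp T) (e : E) :
    SmoothOp (fun g => T (fun y => fderiv ℝ g y e)) where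
  smooth G hG := hT.smooth (fun y s => fderiv ℝ (fun z => G z s) y e) (contDiff_fderiv_uncurry hG e)
  deriv_comm G hG s x t := by
    rw [← hT.deriv_comm (fun y s => fderiv ℝ (fun z => G z s) y e) (contDiff_fderiv_uncurry hG e)]
    simp only [fderiv_deriv_comm hG]
  translate g hg e' x t := by
    rw [← hT.translate _ ((hg.fderiv_right (by simp)).clm_apply contDiff_const)]
    simp only [fderiv_comp_add_right]
  add g h hg hh x t := by
    rw [← hT.add _ _ ((hg.fderiv_right (by simp)).clm_apply contDiff_const)
      ((hh.fderiv_right (by simp)).clm_apply contDiff_const)]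
    congr 1
    ext y
    rw [fderiv_fun_add (hg.differentiable (by simp) y) (hh.differentiable (by simp) y)]
    rfl
  smul c g hg x t := by
    rw [← hT.smul _ _ ((hg.fderiv_right (by simp)).clm_apply contDiff_const)]
    congr 1
    ext y
    rw [fderiv_fun_const_smul (hg.differentiable (by simp) y)]
    rfl

theorem deriv (hT : SmoothOp T) : SmoothOp (fun g x t => deriv (T g x) t) where
  smooth G hG := by
    have h := contDiff_deriv_uncurry (E := E × ℝ) (G := fun p t => T (fun y => G y p.2) p.1 t)
      ((hT.smooth G hG).comp (f := fun p : (E × ℝ) × ℝ => (p.1.1, p.1.2, p.2)) (by fun_prop))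
    exact h.comp (f := fun p : E × ℝ × ℝ => ((p.1, p.2.1), p.2.2)) (by fun_prop)
  deriv_comm G hG s x t := by
    rw [← deriv_deriv_comm (hT.contDiff_param hG x)]
    congr 1
    ext t
    exact hT.deriv_comm G hG s x t
  translate g hg e x t := by
    congr 1
    ext t
    exact hT.translate g hg e x t
  add g h hg hh x t := by
    rw [← deriv_fun_add ((hT.contDiff_right hg x).differentiable (by simp) t)
      ((hT.contDiff_right hh x).differentiable (by simp) t)]
    congr 1
    ext t
    exact hT.add g h hg hh x t
  smul c g hg x t := by
    rw [← deriv_fun_const_smul_field]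
    congr 1
    ext t
    exact hT.smul c g hg x t

theorem iteratedDeriv (hT : SmoothOp T) (k : ℕ) :
    SmoothOp (fun g x t => iteratedDeriv k (T g x) t) := by
  induction k with
  | zero => simpa using hT
  | succ k ih => simpa only [iteratedDeriv_succ] using ih.deriv

variable [FiniteDimensional ℝ E] [CompleteSpace F]

theorem conv (hT : SmoothOp T) {k : ℝ → ℝ} (hk : ContDiff ℝ ∞ k) :
    SmoothOp (fun g x t => ∫ τ in (0 : ℝ)..t, k (t - τ) • T g x τ) where
  smooth G hG := by
    refine contDiff_integral_upper (X := E × ℝ × ℝ)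
      (H := fun p : (E × ℝ × ℝ) × ℝ => k (p.1.2.2 - p.2) • T (fun y => G y p.1.2.1) p.1.1 p.2)
      ?_ (by fun_prop)
    exact (hk.comp (by fun_prop)).smul ((hT.smooth G hG).comp
      (f := fun p : (E × ℝ × ℝ) × ℝ => (p.1.1, p.1.2.1, p.2)) (by fun_prop))
  deriv_comm G hG s x t := by
    rw [deriv_intervalIntegral_param (H := fun p => k (t - p.2) • T (fun y => G y p.1) x p.2)]
    · simp only [hT.deriv_comm G hG, deriv_fun_const_smul_field]
    · exact (hk.comp (by fun_prop)).smul (hT.contDiff_param hG x)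
  translate g hg e x t := by simp only [hT.translate g hg]
  add g h hg hh x t := by
    simp only [hT.add g h hg hh, smul_add]
    have hc : Continuous fun τ => k (t - τ) := hk.continuous.comp (by fun_prop)
    rw [intervalIntegral.integral_add]
    · exact (hc.smul (hT.contDiff_right hg x).continuous).intervalIntegrable _ _
    · exact (hc.smul (hT.contDiff_right hh x).continuous).intervalIntegrable _ _
  smul c g hg x t := by
    simp only [hT.smul c g hg, smul_comm _ c]
    rw [intervalIntegral.integral_smul]

theorem prim (hT : SmoothOp T) : SmoothOp (fun g x t => ∫ τ in (0 : ℝ)..t, T g x τ) := by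
  simpa using hT.conv (contDiff_const (c := (1 : ℝ)))

theorem integral_translates [MeasurableSpace E] [BorelSpace E] (μ : Measure E) [IsFiniteMeasure μ]
    {K : Set E} (hK : IsCompact K) (hμ : ∀ᵐ v ∂μ, v ∈ K) :
    SmoothOp (fun (g : E → F) x t => ∫ v, g (x + t • v) ∂μ) where
  smooth G hG := contDiff_integral_param (X := E × ℝ × ℝ) μ hK hμ
    (H := fun p : (E × ℝ × ℝ) × E => G (p.1.1 + p.1.2.2 • p.2) p.1.2.1)
    (hG.comp (f := fun p : (E × ℝ × ℝ) × E => (p.1.1 + p.1.2.2 • p.2, p.1.2.1)) (by fun_prop))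
  deriv_comm G hG s x t := (deriv_integral_param μ hK hμ
    (H := fun p : ℝ × E => G (x + t • p.2) p.1)
    (hG.comp (f := fun p : ℝ × E => (x + t • p.2, p.1)) (by fun_prop)) s).symm
  translate g hg e x t := by simp only [add_right_comm]
  add g h hg hh x t := by
    rw [integral_add]
    · exact integrable_of_continuous_of_ae_mem_compact μ hK hμ (hg.continuous.comp (by fun_prop))
    · exact integrable_of_continuous_of_ae_mem_compact μ hK hμ (hh.continuous.comp (by fun_prop))
  smul c g hg x t := integral_smul c _

end SmoothOp

end SmoothOp

/-! ### Powers of the Laplacian -/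

section LapPow

variable {n : ℕ} {F : Type*} [NormedAddCommGroup F] [NormedSpace ℝ F]

theorem laplacian_eq_sum_fderiv_fderiv {g : EuclideanSpace ℝ (Fin n) → F} (hg : ContDiff ℝ ∞ g)
    (x : EuclideanSpace ℝ (Fin n)) :
    Laplacian.laplacian g x = ∑ i, fderiv ℝ
    (fun y => fderiv ℝ g y (EuclideanSpace.basisFun (Fin n) ℝ i))
      x (EuclideanSpace.basisFun (Fin n) ℝ i) := by
  rw [InnerProductSpace.laplacian_eq_iteratedFDeriv_orthonormalBasis g
    (EuclideanSpace.basisFun (Fin n) ℝ)]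
  refine sum_congr rfl fun i _ => ?_
  have hd : DifferentiableAt ℝ (fderiv ℝ g) x :=
    (hg.fderiv_right (m := ∞) (by simp)).differentiable (by simp) x
  rw [fderiv_clm_apply hd (differentiableAt_const _), iteratedFDeriv_two_apply]
  simp

theorem contDiff_fderiv_apply {g : EuclideanSpace ℝ (Fin n) → F} (hg : ContDiff ℝ ∞ g)
    (e : EuclideanSpace ℝ (Fin n)) :
    ContDiff ℝ ∞ (fun y => fderiv ℝ g y e) :=
  (hg.fderiv_right (by simp)).clm_apply contDiff_const

theorem contDiff_laplacian {g : EuclideanSpace ℝ (Fin n) → F} (hg : ContDiff ℝ ∞ g) :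
    ContDiff ℝ ∞ (Laplacian.laplacian g) := by
  rw [funext (laplacian_eq_sum_fderiv_fderiv hg)]
  exact ContDiff.sum fun i _ => contDiff_fderiv_apply (contDiff_fderiv_apply hg _) _

theorem lapPow_zero (g : EuclideanSpace ℝ (Fin n) → F) : lapPow 0 g = g := rfl

theorem lapPow_succ (k : ℕ) (g : EuclideanSpace ℝ (Fin n) → F) : lapPow (k + 1) g = lapPow k
    (Laplacian.laplacian g) := rfl

theorem lapPow_succ' (k : ℕ) (g : EuclideanSpace ℝ (Fin n) → F) : lapPow (k + 1) g =
    Laplacian.laplacian (lapPow k g) :=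
  Function.iterate_succ_apply' _ _ _

theorem lapPow_add (j k : ℕ) (g : EuclideanSpace ℝ (Fin n) → F) : lapPow (j + k) g = lapPow j
    (lapPow k g) :=
  Function.iterate_add_apply _ _ _ _

theorem contDiff_lapPow (k : ℕ) {g : EuclideanSpace ℝ (Fin n) → F} (hg : ContDiff ℝ ∞ g) : ContDiff
    ℝ ∞ (lapPow k g) := by
  induction k generalizing g with
  | zero => exact hg
  | succ k ih => exact ih (contDiff_laplacian hg)

namespace SmoothOp

variable {T : (EuclideanSpace ℝ (Fin n) → F) → EuclideanSpace ℝ (Fin n) → ℝ → F}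

theorem laplacian_comm (hT : SmoothOp T) {g : EuclideanSpace ℝ (Fin n) → F} (hg : ContDiff ℝ ∞ g)
    (x : EuclideanSpace ℝ (Fin n)) (t : ℝ) :
    T (Laplacian.laplacian g) x t = Laplacian.laplacian (fun y => T g y t) x := by
  have h1 := fun e => contDiff_fderiv_apply hg e
  rw [laplacian_eq_sum_fderiv_fderiv (contDiff_slice (hT.contDiff hg) t),
    funext (laplacian_eq_sum_fderiv_fderiv hg),
    hT.map_sum _ _ fun i _ => contDiff_fderiv_apply (h1 _) _]
  refine sum_congr rfl fun i _ => ?_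
  rw [hT.fderiv_comm (h1 _)]
  simp only [hT.fderiv_comm hg]

theorem lapPow_comm (hT : SmoothOp T) (k : ℕ) {g : EuclideanSpace ℝ (Fin n) → F}
    (hg : ContDiff ℝ ∞ g) (x : EuclideanSpace ℝ (Fin n)) (t : ℝ) :
    T (lapPow k g) x t = lapPow k (fun y => T g y t) x := by
  induction k generalizing g with
  | zero => rfl
  | succ k ih =>
    rw [lapPow_succ, ih (contDiff_laplacian hg), lapPow_succ]
    simp only [hT.laplacian_comm hg]

theorem comp_laplacian (hT : SmoothOp T) : SmoothOp (fun g => T (Laplacian.laplacian g)) := by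
  refine (SmoothOp.sum univ fun i _ => (hT.comp_fderiv (EuclideanSpace.basisFun (Fin n) ℝ i)).comp_fderiv
    (EuclideanSpace.basisFun (Fin n) ℝ i)).congr fun g hg x t => ?_
  rw [funext (laplacian_eq_sum_fderiv_fderiv hg),
    hT.map_sum _ _ fun i _ => contDiff_fderiv_apply (contDiff_fderiv_apply hg _) _]

theorem comp_lapPow (hT : SmoothOp T) (k : ℕ) : SmoothOp (fun g => T (lapPow k g)) := by
  induction k with
  | zero => exact hT
  | succ k ih => exact ih.comp_laplacian

end SmoothOp

/-- Powers of the Laplacian, as operators that are constant in time. -/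
theorem smoothOp_lapPow (k : ℕ) :
    SmoothOp (fun (g : EuclideanSpace ℝ (Fin n) → F) x (_ : ℝ) => lapPow k g x) :=
  SmoothOp.const.comp_lapPow k

theorem contDiff_lapPow_uncurry (k : ℕ) {G : EuclideanSpace ℝ (Fin n) → ℝ → F}
    (hG : ContDiff ℝ ∞ (fun p : EuclideanSpace ℝ (Fin n) × ℝ => G p.1 p.2)) :
    ContDiff ℝ ∞ (fun p : EuclideanSpace ℝ (Fin n) × ℝ => lapPow k (fun y => G y p.2) p.1) :=
  ((smoothOp_lapPow k).smooth G hG).comp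
    (f := fun p : EuclideanSpace ℝ (Fin n) × ℝ => (p.1, p.2, (0 : ℝ))) (by fun_prop)

theorem lapPow_sum {ι : Type*} (k : ℕ) (s : Finset ι) (g : ι → EuclideanSpace ℝ (Fin n) → F)
    (hg : ∀ i ∈ s, ContDiff ℝ ∞ (g i)) (x : EuclideanSpace ℝ (Fin n)) :
    lapPow k (fun y => ∑ i ∈ s, g i y) x = ∑ i ∈ s, lapPow k (g i) x :=
  (smoothOp_lapPow k).map_sum s g hg x 0

theorem lapPow_const_smul (k : ℕ) (c : ℝ) {g : EuclideanSpace ℝ (Fin n) → F} (hg : ContDiff ℝ ∞ g)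
    (x : EuclideanSpace ℝ (Fin n)) :
    lapPow k (fun y => c • g y) x = c • lapPow k g x :=
  (smoothOp_lapPow k).smul c g hg x 0

theorem lapPow_fun_add (k : ℕ) {g h : EuclideanSpace ℝ (Fin n) → F} (hg : ContDiff ℝ ∞ g)
    (hh : ContDiff ℝ ∞ h) (x : EuclideanSpace ℝ (Fin n)) :
    lapPow k (fun y => g y + h y) x = lapPow k g x + lapPow k h x :=
  (smoothOp_lapPow k).add g h hg hh x 0

theorem lapPow_deriv (k : ℕ) {G : EuclideanSpace ℝ (Fin n) → ℝ → F}
    (hG : ContDiff ℝ ∞ (fun p : EuclideanSpace ℝ (Fin n) × ℝ => G p.1 p.2))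
    (x : EuclideanSpace ℝ (Fin n)) (t : ℝ) :
    lapPow k (fun y => deriv (G y) t) x = deriv (fun t => lapPow k (fun y => G y t) x) t :=
  (smoothOp_lapPow k).deriv_comm G hG t x 0

theorem lapPow_iteratedDeriv (k j : ℕ) {G : EuclideanSpace ℝ (Fin n) → ℝ → F}
    (hG : ContDiff ℝ ∞ (fun p : EuclideanSpace ℝ (Fin n) × ℝ => G p.1 p.2))
    (x : EuclideanSpace ℝ (Fin n)) (t : ℝ) :
    lapPow k (fun y => iteratedDeriv j (G y) t) x =
      iteratedDeriv j (fun t => lapPow k (fun y => G y t) x) t := by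
  induction j generalizing t with
  | zero => simp
  | succ j ih =>
    simp only [iteratedDeriv_succ]
    rw [lapPow_deriv k (G := fun y s => iteratedDeriv j (G y) s)
      (contDiff_iteratedDeriv_uncurry hG j)]
    simp only [ih]

theorem lapPow_intervalIntegral [CompleteSpace F] (k : ℕ) {G : EuclideanSpace ℝ (Fin n) → ℝ → F}
    (hG : ContDiff ℝ ∞ (fun p : EuclideanSpace ℝ (Fin n) × ℝ => G p.1 p.2))
    (x : EuclideanSpace ℝ (Fin n)) (t : ℝ) :
    lapPow k (fun y => ∫ τ in (0 : ℝ)..t, G y τ) x =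
      ∫ τ in (0 : ℝ)..t, lapPow k (fun y => G y τ) x := by
  induction k generalizing x with
  | zero => rfl
  | succ k ih =>
    have hG' := contDiff_lapPow_uncurry k hG
    rw [lapPow_succ', funext ih, laplacian_eq_sum_fderiv_fderiv
      (contDiff_integral_upper hG' contDiff_const)]
    simp only [fderiv_intervalIntegral_apply hG']
    have h1 := contDiff_fderiv_uncurry (G := fun y τ => lapPow k (fun z => G z τ) y) hG'
    simp only [fderiv_intervalIntegral_apply (h1 _)]
    have h2 := fun e => contDiff_fderiv_uncurry
      (G := fun y τ => fderiv ℝ (fun y => lapPow k (fun z => G z τ) y) y e) (h1 e)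
    refine (intervalIntegral.integral_finsetSum fun i _ =>
      (contDiff_slice_right (G := fun y τ => fderiv ℝ (fun z => fderiv ℝ (fun y =>
        lapPow k (fun z => G z τ) y) z (EuclideanSpace.basisFun (Fin n) ℝ i)) y
          (EuclideanSpace.basisFun (Fin n) ℝ i)) (h2 _ _) x).continuous.intervalIntegrable
            _ _).symm.trans ?_
    refine intervalIntegral.integral_congr fun τ _ => ?_
    rw [lapPow_succ', laplacian_eq_sum_fderiv_fderiv (contDiff_lapPow k (contDiff_slice hG τ))]

end LapPow

/-! ### The Cauchy problem solved by an abstract propagator -/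

section Propagator

variable {n : ℕ} {F : Type*} [NormedAddCommGroup F] [NormedSpace ℝ F]

theorem cauchyOp_add (m : ℕ) (b : ℕ → ℝ) {u v : EuclideanSpace ℝ (Fin n) → ℝ → F}
    (hu : ContDiff ℝ ∞ (fun p : EuclideanSpace ℝ (Fin n) × ℝ => u p.1 p.2))
    (hv : ContDiff ℝ ∞ (fun p : EuclideanSpace ℝ (Fin n) × ℝ => v p.1 p.2))
    (x : EuclideanSpace ℝ (Fin n)) (t : ℝ) :
    cauchyOp m b (fun x t => u x t + v x t) x t = cauchyOp m b u x t + cauchyOp m b v x t := by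
  simp only [cauchyOp]
  rw [← sum_add_distrib]
  refine sum_congr rfl fun k _ => ?_
  rw [← smul_add, ← lapPow_fun_add _ (contDiff_slice (contDiff_iteratedDeriv_uncurry hu _) t)
    (contDiff_slice (contDiff_iteratedDeriv_uncurry hv _) t)]
  congr 2
  ext y
  exact iteratedDeriv_fun_add (contDiff_infty.1 (contDiff_slice_right hu y) _).contDiffAt
    (contDiff_infty.1 (contDiff_slice_right hv y) _).contDiffAt

theorem cauchyOp_const_smul (m : ℕ) (b : ℕ → ℝ) (c : ℝ) {u : EuclideanSpace ℝ (Fin n) → ℝ → F}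
    (hu : ContDiff ℝ ∞ (fun p : EuclideanSpace ℝ (Fin n) × ℝ => u p.1 p.2))
    (x : EuclideanSpace ℝ (Fin n)) (t : ℝ) :
    cauchyOp m b (fun x t => c • u x t) x t = c • cauchyOp m b u x t := by
  simp only [cauchyOp, smul_sum]
  refine sum_congr rfl fun k _ => ?_
  rw [smul_comm c, ← lapPow_const_smul _ c (contDiff_slice (contDiff_iteratedDeriv_uncurry hu _) t)]
  congr 2
  ext y
  rw [iteratedDeriv_fun_const_smul_field]

theorem cauchyOp_sum (m : ℕ) (b : ℕ → ℝ) {ι : Type*} (s : Finset ι)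
    {u : ι → EuclideanSpace ℝ (Fin n) → ℝ → F}
    (hu : ∀ i ∈ s, ContDiff ℝ ∞ (fun p : EuclideanSpace ℝ (Fin n) × ℝ => u i p.1 p.2))
    (x : EuclideanSpace ℝ (Fin n)) (t : ℝ) :
    cauchyOp m b (fun x t => ∑ i ∈ s, u i x t) x t = ∑ i ∈ s, cauchyOp m b (u i) x t := by
  classical
  induction s using Finset.induction_on with
  | empty =>
    simpa using cauchyOp_const_smul m b 0 (u := fun _ _ => (0 : F)) contDiff_const x t
  | insert i s hi ih =>
    have h' : ∀ j ∈ s, ContDiff ℝ ∞ (fun p : EuclideanSpace ℝ (Fin n) × ℝ => u j p.1 p.2) :=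
      fun j hj => hu j (mem_insert_of_mem hj)
    simp only [sum_insert hi]
    rw [← ih h']
    exact cauchyOp_add m b (hu i (mem_insert_self i s)) (ContDiff.sum h') x t

theorem cauchyOp_iteratedDeriv (m : ℕ) (b : ℕ → ℝ) (j : ℕ)
    {u : EuclideanSpace ℝ (Fin n) → ℝ → F}
    (hu : ContDiff ℝ ∞ (fun p : EuclideanSpace ℝ (Fin n) × ℝ => u p.1 p.2))
    (x : EuclideanSpace ℝ (Fin n)) (t : ℝ) :
    cauchyOp m b (fun x t => iteratedDeriv j (u x) t) x t =
      iteratedDeriv j (cauchyOp m b u x) t := by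
  have hs : ∀ k ∈ range (m + 1), ContDiffAt ℝ j (fun t => b (2 * k) •
      lapPow (m - k) (fun y => iteratedDeriv (2 * k) (u y) t) x) t := fun k _ =>
    (contDiff_infty.1 ((contDiff_slice_right
      (G := fun x t => lapPow (m - k) (fun y => iteratedDeriv (2 * k) (u y) t) x)
      (contDiff_lapPow_uncurry _ (contDiff_iteratedDeriv_uncurry hu _)) x).const_smul
        (b (2 * k))) j).contDiffAt
  refine Eq.trans ?_ (iteratedDeriv_fun_sum hs).symm
  refine sum_congr rfl fun k _ => ?_
  rw [iteratedDeriv_fun_const_smul_field, ← lapPow_iteratedDeriv _ j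
    (G := fun y t => iteratedDeriv (2 * k) (u y) t) (contDiff_iteratedDeriv_uncurry hu _)]
  congr 2
  ext y
  simp only [iteratedDeriv_eq_iterate, ← Function.iterate_add_apply, add_comm]

/-- Moving the Laplacians onto the data turns the equation into an identity in `t` at a fixed `x`.
-/
theorem cauchyOp_smoothOp (m : ℕ) (b : ℕ → ℝ) {T : (EuclideanSpace ℝ (Fin n) → F) →
    EuclideanSpace ℝ (Fin n) → ℝ → F} (hT : SmoothOp T) {g : EuclideanSpace ℝ (Fin n) → F}
    (hg : ContDiff ℝ ∞ g) (x : EuclideanSpace ℝ (Fin n)) (t : ℝ) :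
    cauchyOp m b (T g) x t =
      ∑ k ∈ range (m + 1), b (2 * k) • iteratedDeriv (2 * k) (T (lapPow (m - k) g) x) t := by
  refine sum_congr rfl fun k _ => ?_
  rw [(hT.iteratedDeriv (2 * k)).lapPow_comm _ hg]

/-- `W g` solves the homogeneous equation with data `0, …, 0, g`. -/
structure IsPropagator (m : ℕ) (b : ℕ → ℝ) (W : (EuclideanSpace ℝ (Fin n) → F) →
    EuclideanSpace ℝ (Fin n) → ℝ → F) : Prop where
  smoothOp : SmoothOp W
  init_zero : ∀ g, ContDiff ℝ ∞ g → ∀ r < 2 * m - 1, ∀ x, iteratedDeriv r (W g x) 0 = 0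
  init_last : ∀ g, ContDiff ℝ ∞ g → ∀ x, iteratedDeriv (2 * m - 1) (W g x) 0 = g x
  eqn : ∀ g, ContDiff ℝ ∞ g → ∀ x t, cauchyOp m b (W g) x t = 0

/-- Duhamel's integral for the operator `W`. -/
def duhamel (W : (EuclideanSpace ℝ (Fin n) → F) → EuclideanSpace ℝ (Fin n) → ℝ → F)
    (f : EuclideanSpace ℝ (Fin n) → ℝ → F) (x : EuclideanSpace ℝ (Fin n)) (t : ℝ) : F :=
  ∫ τ in (0 : ℝ)..t, W (fun ξ => f ξ τ) x (t - τ)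

/-- The contribution of the initial data to the solution. -/
def dataPart (m : ℕ) (b : ℕ → ℝ) (W : (EuclideanSpace ℝ (Fin n) → F) →
    EuclideanSpace ℝ (Fin n) → ℝ → F) (phi : ℕ → EuclideanSpace ℝ (Fin n) → F)
    (x : EuclideanSpace ℝ (Fin n)) (t : ℝ) : F :=
  ∑ k ∈ range (m + 1), ∑ r ∈ range (2 * k),
    b (2 * k) • iteratedDeriv (2 * k - 1 - r) (W (lapPow (m - k) (phi r)) x) t

/-- The Laplacians of the explicit formula pass through `W` to the data. The term `k = 0`, present
only in `dataPart`, is an empty sum over `r`. -/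
theorem sum_smul_lapPow_eq_dataPart (m : ℕ) (b : ℕ → ℝ) {W : (EuclideanSpace ℝ (Fin n) → F) →
    EuclideanSpace ℝ (Fin n) → ℝ → F} (hW : SmoothOp W) {phi : ℕ → EuclideanSpace ℝ (Fin n) → F}
    (hphi : ∀ r < 2 * m, ContDiff ℝ ∞ (phi r)) (x : EuclideanSpace ℝ (Fin n)) (t : ℝ) :
    ∑ k ∈ Icc 1 m, b (2 * k) • lapPow (m - k) (fun y =>
      ∑ r ∈ range (2 * k), iteratedDeriv (2 * k - 1 - r) (W (phi r) y) t) x =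
    dataPart m b W phi x t := by
  have hsub : Icc 1 m ⊆ range (m + 1) := fun k hk => by
    simp only [mem_Icc, mem_range] at *
    omega
  rw [dataPart, ← sum_subset hsub]
  · refine sum_congr rfl fun k hk => ?_
    have hr : ∀ r ∈ range (2 * k), ContDiff ℝ ∞ (phi r) := fun r hr => hphi r (by
      simp only [mem_Icc, mem_range] at *
      omega)
    rw [lapPow_sum _ _ _ fun r h =>
      contDiff_slice ((hW.iteratedDeriv (2 * k - 1 - r)).contDiff (hr r h)) t, smul_sum]
    exact sum_congr rfl fun r h => by
      rw [(hW.iteratedDeriv (2 * k - 1 - r)).lapPow_comm _ (hr r h)]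
  · intro k hk hk'
    obtain rfl : k = 0 := by
      simp only [mem_Icc, mem_range] at *
      omega
    simp

namespace SmoothOp

variable {W : (EuclideanSpace ℝ (Fin n) → F) → EuclideanSpace ℝ (Fin n) → ℝ → F}
  {f : EuclideanSpace ℝ (Fin n) → ℝ → F}

theorem contDiff_duhamel (hW : SmoothOp W)
    (hf : ContDiff ℝ ∞ (fun p : EuclideanSpace ℝ (Fin n) × ℝ => f p.1 p.2)) :
    ContDiff ℝ ∞ (fun p : EuclideanSpace ℝ (Fin n) × ℝ => duhamel W f p.1 p.2) :=
  contDiff_integral_upper (X := EuclideanSpace ℝ (Fin n) × ℝ)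
    (H := fun p => W (fun ξ => f ξ p.2) p.1.1 (p.1.2 - p.2))
    ((hW.smooth f hf).comp (f := fun p : (EuclideanSpace ℝ (Fin n) × ℝ) × ℝ =>
      (p.1.1, p.2, p.1.2 - p.2)) (by fun_prop)) contDiff_snd

variable [CompleteSpace F]

theorem deriv_duhamel (hW : SmoothOp W)
    (hf : ContDiff ℝ ∞ (fun p : EuclideanSpace ℝ (Fin n) × ℝ => f p.1 p.2))
    (x : EuclideanSpace ℝ (Fin n)) (t : ℝ) :
    _root_.deriv (duhamel W f x) t =
      W (fun ξ => f ξ t) x 0 + duhamel (fun g x t => _root_.deriv (W g x) t) f x t :=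
  deriv_integral_conv (hW.contDiff_param hf x) t

theorem lapPow_duhamel (hW : SmoothOp W)
    (hf : ContDiff ℝ ∞ (fun p : EuclideanSpace ℝ (Fin n) × ℝ => f p.1 p.2)) (k : ℕ)
    (x : EuclideanSpace ℝ (Fin n)) (t : ℝ) :
    lapPow k (fun y => duhamel W f y t) x =
      ∫ τ in (0 : ℝ)..t, W (lapPow k (fun ξ => f ξ τ)) x (t - τ) := by
  have h : ContDiff ℝ ∞ (fun p : EuclideanSpace ℝ (Fin n) × ℝ =>
      W (fun ξ => f ξ p.2) p.1 (t - p.2)) :=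
    (hW.smooth f hf).comp (f := fun p : EuclideanSpace ℝ (Fin n) × ℝ => (p.1, p.2, t - p.2))
      (by fun_prop)
  refine (lapPow_intervalIntegral k (G := fun y τ => W (fun ξ => f ξ τ) y (t - τ)) h x t).trans ?_
  simp only [hW.lapPow_comm k (contDiff_slice hf _)]

end SmoothOp

namespace IsPropagator

variable {m : ℕ} {b : ℕ → ℝ} {W : (EuclideanSpace ℝ (Fin n) → F) →
    EuclideanSpace ℝ (Fin n) → ℝ → F} {phi : ℕ → EuclideanSpace ℝ (Fin n) → F}
    {f : EuclideanSpace ℝ (Fin n) → ℝ → F}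

theorem contDiff_dataPart_term (hW : IsPropagator m b W)
    (hphi : ∀ r < 2 * m, ContDiff ℝ ∞ (phi r)) {k r : ℕ} (hk : k ∈ range (m + 1))
    (hr : r ∈ range (2 * k)) :
    ContDiff ℝ ∞ (fun p : EuclideanSpace ℝ (Fin n) × ℝ =>
      b (2 * k) • iteratedDeriv (2 * k - 1 - r) (W (lapPow (m - k) (phi r)) p.1) p.2) := by
  simp only [mem_range] at hk hr
  exact ((hW.smoothOp.iteratedDeriv _).contDiff (contDiff_lapPow _ (hphi r (by omega)))).const_smul
    _

theorem contDiff_dataPart (hW : IsPropagator m b W) (hphi : ∀ r < 2 * m, ContDiff ℝ ∞ (phi r)) :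
    ContDiff ℝ ∞ (fun p : EuclideanSpace ℝ (Fin n) × ℝ => dataPart m b W phi p.1 p.2) :=
  ContDiff.sum fun _ hk => ContDiff.sum fun _ hr => hW.contDiff_dataPart_term hphi hk hr

theorem cauchyOp_dataPart (hW : IsPropagator m b W) (hphi : ∀ r < 2 * m, ContDiff ℝ ∞ (phi r))
    (x : EuclideanSpace ℝ (Fin n)) (t : ℝ) : cauchyOp m b (dataPart m b W phi) x t = 0 := by
  refine (cauchyOp_sum m b (range (m + 1)) (fun k hk => ContDiff.sum fun r hr =>
    hW.contDiff_dataPart_term hphi hk hr) x t).trans (sum_eq_zero fun k hk => ?_)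
  refine (cauchyOp_sum m b (range (2 * k)) (fun r hr =>
    hW.contDiff_dataPart_term hphi hk hr) x t).trans (sum_eq_zero fun r hr => ?_)
  simp only [mem_range] at hk hr
  have hg := contDiff_lapPow (m - k) (hphi r (by omega))
  rw [cauchyOp_const_smul m b _ ((hW.smoothOp.iteratedDeriv _).contDiff hg),
    cauchyOp_iteratedDeriv m b _ (hW.smoothOp.contDiff hg), funext (hW.eqn _ hg x)]
  simp [iteratedDeriv_fun_const_zero]

/-- At time `0` the `k, r` term carries the derivative of `W` of order `2k - 1 + q - r`. For `r = q`
only `k = m` reaches order `2m - 1` and gives `φ_q`; for `r > q` all orders are too small; for `r <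
q` the sum over `k` is a time derivative of `P W φ_r = 0`. -/
theorem iteratedDeriv_dataPart_zero (hW : IsPropagator m b W) (hb : b (2 * m) = 1)
    (hphi : ∀ r < 2 * m, ContDiff ℝ ∞ (phi r)) {q : ℕ} (hq : q < 2 * m)
    (x : EuclideanSpace ℝ (Fin n)) : iteratedDeriv q (dataPart m b W phi x) 0 = phi q x := by
  have hD : iteratedDeriv q (dataPart m b W phi x) 0 = ∑ k ∈ range (m + 1), ∑ r ∈ range (2 * k),
      b (2 * k) • iteratedDeriv (q + (2 * k - 1 - r)) (W (lapPow (m - k) (phi r)) x) 0 := by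
    have hs := fun k hk r hr => contDiff_slice_right (G := fun x t => b (2 * k) •
      iteratedDeriv (2 * k - 1 - r) (W (lapPow (m - k) (phi r)) x) t)
      (hW.contDiff_dataPart_term hphi (k := k) (r := r) hk hr) x
    refine (iteratedDeriv_fun_sum fun k hk =>
      (contDiff_infty.1 (ContDiff.sum (hs k hk)) q).contDiffAt).trans (sum_congr rfl fun k hk => ?_)
    refine (iteratedDeriv_fun_sum fun r hr =>
      (contDiff_infty.1 (hs k hk r hr) q).contDiffAt).trans (sum_congr rfl fun r hr => ?_)
    rw [iteratedDeriv_fun_const_smul_field]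
    simp only [iteratedDeriv_eq_iterate, ← Function.iterate_add_apply]
  rw [hD, sum_comm' (t' := range (2 * m)) (s' := fun r => {k ∈ range (m + 1) | r < 2 * k})
    (by intro k r; simp only [mem_range, mem_filter]; omega)]
  have hzero : ∀ k r j, k ≤ m → r < 2 * m → j < 2 * m - 1 →
      b (2 * k) • iteratedDeriv j (W (lapPow (m - k) (phi r)) x) 0 = 0 := fun k r j _ hr hj => by
    rw [hW.init_zero _ (contDiff_lapPow _ (hphi r hr)) j hj, smul_zero]
  rw [sum_eq_single_of_mem q (mem_range.2 hq)]
  · rw [sum_eq_single_of_mem m (by simp only [mem_range, mem_filter]; omega)]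
    · rw [show q + (2 * m - 1 - q) = 2 * m - 1 by omega, Nat.sub_self, lapPow_zero, hb, one_smul,
        hW.init_last _ (hphi q hq)]
    · intro k hk hkm
      simp only [mem_range, mem_filter] at hk
      exact hzero k q _ (by omega) hq (by omega)
  · intro r hr hrq
    rw [mem_range] at hr
    rcases lt_or_gt_of_ne hrq with h | h
    -- The sum runs only over `k` with `r < 2k`. The missing terms have order at most `q - 1 < 2m -
    -- 1`, hence vanish at `0`, so the sum may be completed to the one coming from `P`.
    · have hP : ∑ k ∈ range (m + 1), b (2 * k) •
          iteratedDeriv (2 * k + (q - 1 - r)) (W (lapPow (m - k) (phi r)) x) 0 = 0 := by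
        have h1 := cauchyOp_iteratedDeriv m b (q - 1 - r) (hW.smoothOp.contDiff (hphi r hr)) x 0
        rw [funext (hW.eqn _ (hphi r hr) x)] at h1
        rw [cauchyOp_smoothOp m b (hW.smoothOp.iteratedDeriv _) (hphi r hr)] at h1
        simp only [iteratedDeriv_eq_iterate, ← Function.iterate_add_apply] at h1 ⊢
        rw [h1]
        simp [← iteratedDeriv_eq_iterate]
      rw [← hP, sum_filter]
      refine sum_congr rfl fun k hk => ?_
      rw [mem_range] at hk
      split_ifs with hrk
      · rw [show q + (2 * k - 1 - r) = 2 * k + (q - 1 - r) by omega]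
      · rw [hzero k r _ (by omega) hr (by omega)]
    · refine sum_eq_zero fun k hk => ?_
      simp only [mem_range, mem_filter] at hk
      exact hzero k r _ (by omega) hr (by omega)

variable [CompleteSpace F]

theorem iteratedDeriv_duhamel (hW : IsPropagator m b W)
    (hf : ContDiff ℝ ∞ (fun p : EuclideanSpace ℝ (Fin n) × ℝ => f p.1 p.2))
    (x : EuclideanSpace ℝ (Fin n)) {r : ℕ} (hr : r ≤ 2 * m - 1) (t : ℝ) :
    iteratedDeriv r (duhamel W f x) t =
      duhamel (fun g x t => iteratedDeriv r (W g x) t) f x t := by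
  induction r generalizing t with
  | zero => simp [duhamel]
  | succ r ih =>
    rw [iteratedDeriv_succ, funext (ih (by omega)),
      (hW.smoothOp.iteratedDeriv r).deriv_duhamel hf,
      hW.init_zero _ (contDiff_slice hf t) r (by omega), zero_add]
    simp only [iteratedDeriv_succ]

/-- Each differentiation produces a boundary term, the current derivative of `W (f(t))` at time `0`.
It vanishes until order `2m - 1`, where it equals `f`. -/
theorem iteratedDeriv_duhamel_last (hW : IsPropagator m b W) (hm : 0 < m)
    (hf : ContDiff ℝ ∞ (fun p : EuclideanSpace ℝ (Fin n) × ℝ => f p.1 p.2))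
    (x : EuclideanSpace ℝ (Fin n)) (t : ℝ) :
    iteratedDeriv (2 * m) (duhamel W f x) t =
      f x t + duhamel (fun g x t => iteratedDeriv (2 * m) (W g x) t) f x t := by
  obtain ⟨r, hr⟩ : ∃ r, 2 * m = r + 1 := ⟨2 * m - 1, by omega⟩
  have hr' : 2 * m - 1 = r := by omega
  have h := hW.init_last _ (contDiff_slice hf t) x
  rw [hr'] at h
  rw [hr, iteratedDeriv_succ, funext (hW.iteratedDeriv_duhamel hf x hr'.ge),
    (hW.smoothOp.iteratedDeriv r).deriv_duhamel hf, h]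
  simp only [iteratedDeriv_succ]

theorem cauchyOp_duhamel (hW : IsPropagator m b W) (hm : 0 < m) (hb : b (2 * m) = 1)
    (hf : ContDiff ℝ ∞ (fun p : EuclideanSpace ℝ (Fin n) × ℝ => f p.1 p.2))
    (x : EuclideanSpace ℝ (Fin n)) (t : ℝ) : cauchyOp m b (duhamel W f) x t = f x t := by
  have hc : ∀ k, Continuous fun τ =>
      iteratedDeriv (2 * k) (W (lapPow (m - k) (fun ξ => f ξ τ)) x) (t - τ) := fun k =>
    (((hW.smoothOp.iteratedDeriv (2 * k)).smooth
      (fun y τ => lapPow (m - k) (fun ξ => f ξ τ) y) (contDiff_lapPow_uncurry _ hf)).comp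
      (f := fun τ : ℝ => (x, τ, t - τ)) (by fun_prop)).continuous
  -- Apart from the boundary term, `P` acts under the integral, where `P W (f(τ)) = 0`.
  have hint : ∑ k ∈ range (m + 1), b (2 * k) • ∫ τ in (0 : ℝ)..t,
      iteratedDeriv (2 * k) (W (lapPow (m - k) (fun ξ => f ξ τ)) x) (t - τ) = 0 := by
    simp only [← intervalIntegral.integral_smul]
    refine (intervalIntegral.integral_finsetSum (f := fun k τ => b (2 * k) •
      iteratedDeriv (2 * k) (W (lapPow (m - k) (fun ξ => f ξ τ)) x) (t - τ))
      fun k _ => ((hc k).const_smul (b (2 * k))).intervalIntegrable _ _).symm.trans ?_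
    simp only [← cauchyOp_smoothOp m b hW.smoothOp (contDiff_slice hf _),
      hW.eqn _ (contDiff_slice hf _), intervalIntegral.integral_zero]
  have hterm : ∀ k, lapPow (m - k)
      (fun y => duhamel (fun g x t => iteratedDeriv (2 * k) (W g x) t) f y t) x =
      ∫ τ in (0 : ℝ)..t, iteratedDeriv (2 * k) (W (lapPow (m - k) (fun ξ => f ξ τ)) x) (t - τ) :=
    fun k => (hW.smoothOp.iteratedDeriv (2 * k)).lapPow_duhamel hf (m - k) x t
  have hsum : ∀ k ∈ range (m + 1), b (2 * k) • lapPow (m - k)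
      (fun y => iteratedDeriv (2 * k) (duhamel W f y) t) x = (if k = m then f x t else 0) +
      b (2 * k) • ∫ τ in (0 : ℝ)..t,
        iteratedDeriv (2 * k) (W (lapPow (m - k) (fun ξ => f ξ τ)) x) (t - τ) := by
    intro k hk
    rw [mem_range] at hk
    rw [← hterm]
    split_ifs with hkm
    · subst hkm
      simp only [Nat.sub_self, lapPow_zero]
      rw [hW.iteratedDeriv_duhamel_last hm hf, hb, one_smul, one_smul]
    · rw [funext fun y => hW.iteratedDeriv_duhamel hf y (by omega : 2 * k ≤ 2 * m - 1) t, zero_add]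
  rw [cauchyOp, sum_congr rfl hsum, sum_add_distrib, hint, sum_ite_eq']
  simp

theorem isCauchySolution (hW : IsPropagator m b W) (hm : 0 < m) (hb : b (2 * m) = 1)
    (hf : ContDiff ℝ ∞ (fun p : EuclideanSpace ℝ (Fin n) × ℝ => f p.1 p.2))
    (hphi : ∀ r < 2 * m, ContDiff ℝ ∞ (phi r)) :
    IsCauchySolution m b f phi (fun x t => duhamel W f x t + dataPart m b W phi x t) where
  smooth := (hW.smoothOp.contDiff_duhamel hf).add (hW.contDiff_dataPart hphi)
  eqn x t := by
    rw [cauchyOp_add m b (hW.smoothOp.contDiff_duhamel hf) (hW.contDiff_dataPart hphi),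
      hW.cauchyOp_duhamel hm hb hf, hW.cauchyOp_dataPart hphi, add_zero]
  init r hr x := by
    rw [iteratedDeriv_fun_add
      (contDiff_infty.1 (contDiff_slice_right (hW.smoothOp.contDiff_duhamel hf) x) _).contDiffAt
      (contDiff_infty.1 (contDiff_slice_right (hW.contDiff_dataPart hphi) x) _).contDiffAt,
      hW.iteratedDeriv_dataPart_zero hb hphi hr, hW.iteratedDeriv_duhamel hf x (by omega)]
    simp [duhamel]

/-- A solution is determined by its data through `W`: the expression obtained by propagating the
data of `u` at time `s` up to time `t` has `s`-derivative `W (f s)`. -/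
theorem eq_of_isCauchySolution (hW : IsPropagator m b W) (hm : 0 < m) (hb : b (2 * m) = 1)
    {u : EuclideanSpace ℝ (Fin n) → ℝ → F} (hu : IsCauchySolution m b f phi u)
    (x : EuclideanSpace ℝ (Fin n)) (t : ℝ) :
    u x t = duhamel W f x t + dataPart m b W phi x t := by
  set D : ℕ → (EuclideanSpace ℝ (Fin n) → F) → ℝ → F :=
    fun j g s => iteratedDeriv j (W g x) s with hD
  set U : ℕ → ℝ → EuclideanSpace ℝ (Fin n) → F := fun r s y => iteratedDeriv r (u y) s with hU
  have hUs : ∀ r k, ContDiff ℝ ∞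
      (fun p : EuclideanSpace ℝ (Fin n) × ℝ => lapPow k (U r p.2) p.1) := fun r k =>
    contDiff_lapPow_uncurry k (contDiff_iteratedDeriv_uncurry hu.smooth r)
  have hU1 : ∀ r s, ContDiff ℝ ∞ (U r s) := fun r s =>
    contDiff_slice (G := fun y s => iteratedDeriv r (u y) s)
      (contDiff_iteratedDeriv_uncurry hu.smooth r) s
  have hU0 : ∀ r k s, ContDiff ℝ ∞ (lapPow k (U r s)) := fun r k s => contDiff_lapPow k (hU1 r s)
  -- `Φ s` is the data part at elapsed time `t - s` with the data of `u` at time `s`. It joins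
  -- `dataPart` at `s = 0` to `u x t` at `s = t`.
  set Φ : ℝ → F := fun s => ∑ k ∈ range (m + 1), ∑ r ∈ range (2 * k),
    b (2 * k) • D (2 * k - 1 - r) (lapPow (m - k) (U r s)) (t - s) with hΦ
  have hderiv : ∀ s, HasDerivAt Φ (W (fun ξ => f ξ s) x (t - s)) s := by
    intro s
    set c : ℕ → ℕ → F := fun k r => D (2 * k - r) (lapPow (m - k) (U r s)) (t - s) with hc
    have h1 : HasDerivAt Φ (∑ k ∈ range (m + 1), ∑ r ∈ range (2 * k),
        b (2 * k) • (c k (r + 1) - c k r)) s := by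
      refine HasDerivAt.fun_sum fun k _ => HasDerivAt.fun_sum fun r hr => ?_
      rw [mem_range] at hr
      refine HasDerivAt.const_smul (b (2 * k)) ?_
      have h := hasDerivAt_diag
        ((hW.smoothOp.iteratedDeriv (2 * k - 1 - r)).contDiff_param
          (G := fun y s => lapPow (m - k) (U r s) y) (hUs r (m - k)) x)
        (hasDerivAt_id s) ((hasDerivAt_id s).const_sub t)
      refine h.congr_deriv ?_
      simp only [id, one_smul, neg_smul, ← sub_eq_add_neg, hc, hD]
      rw [show 2 * k - (r + 1) = 2 * k - 1 - r by omega,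
        show 2 * k - r = 2 * k - 1 - r + 1 by omega, iteratedDeriv_succ,
        ← (hW.smoothOp.iteratedDeriv (2 * k - 1 - r)).deriv_comm
          (fun y s => lapPow (m - k) (U r s) y) (hUs r (m - k))]
      congr 3
      ext y
      rw [← lapPow_deriv (m - k) (G := fun y s => U r s y)
        (contDiff_iteratedDeriv_uncurry hu.smooth r)]
      simp only [hU, iteratedDeriv_succ]
    refine h1.congr_deriv ?_
    -- After telescoping only `r = 2k` and `r = 0` remain: the former sum to `W (P u) = W f`, the
    -- latter to `P W (u(s)) = 0`.
    simp only [← smul_sum, sum_range_sub]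
    simp only [smul_sub]
    rw [sum_sub_distrib]
    have h2 := hW.eqn _ (hU1 0 s) x (t - s)
    rw [cauchyOp_smoothOp m b hW.smoothOp (hU1 0 s)] at h2
    simp only [hc, hD, Nat.sub_zero]
    rw [h2, sub_zero, show (fun ξ => f ξ s) = fun ξ => ∑ k ∈ range (m + 1),
      b (2 * k) • lapPow (m - k) (U (2 * k) s) ξ from funext fun ξ => (hu.eqn ξ s).symm,
      hW.smoothOp.map_sum _ _ fun k _ => (hU0 _ _ s).const_smul _]
    refine sum_congr rfl fun k _ => ?_
    rw [hW.smoothOp.smul _ _ (hU0 _ _ s), Nat.sub_self, iteratedDeriv_zero]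
  have hcont : Continuous fun s => W (fun ξ => f ξ s) x (t - s) := by
    -- Smoothness of `f` is inherited from `u` through `f = P u`.
    have hf : ContDiff ℝ ∞ (fun p : EuclideanSpace ℝ (Fin n) × ℝ => f p.1 p.2) := by
      have : ContDiff ℝ ∞ (fun p : EuclideanSpace ℝ (Fin n) × ℝ => cauchyOp m b u p.1 p.2) :=
        ContDiff.sum fun k _ => (hUs _ _).const_smul _
      simpa only [hu.eqn] using this
    exact ((hW.smoothOp.smooth f hf).comp (f := fun s : ℝ => (x, s, t - s)) (by fun_prop)).continuous
  have hFTC := intervalIntegral.integral_eq_sub_of_hasDerivAt (fun s _ => hderiv s)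
    (hcont.intervalIntegrable 0 t)
  have hΦt : Φ t = u x t := by
    simp only [hΦ, sub_self]
    -- At elapsed time zero only derivatives of `W` of order `2m - 1` survive, which forces `k = m`
    -- and `r = 0`.
    rw [sum_eq_single_of_mem m (by simp), sum_eq_single_of_mem 0 (by simp; omega)]
    · simp only [hD, hU, Nat.sub_self, Nat.sub_zero, lapPow_zero, iteratedDeriv_zero, hb, one_smul]
      exact hW.init_last _ (by simpa only [hU, iteratedDeriv_zero] using hU1 0 t) x
    · intro r hr hr0
      rw [mem_range] at hr
      simp only [hD]
      rw [hW.init_zero _ (hU0 _ _ t) _ (by omega), smul_zero]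
    · intro k hk hkm
      rw [mem_range] at hk
      refine sum_eq_zero fun r hr => ?_
      rw [mem_range] at hr
      simp only [hD]
      rw [hW.init_zero _ (hU0 _ _ t) _ (by omega), smul_zero]
  have hΦ0 : Φ 0 = dataPart m b W phi x t := by
    simp only [hΦ, dataPart, sub_zero]
    refine sum_congr rfl fun k hk => sum_congr rfl fun r hr => ?_
    rw [mem_range] at hk hr
    rw [show U r 0 = phi r from funext fun y => hu.init r (by omega) y]
  rw [hΦt, hΦ0] at hFTC
  rw [duhamel, hFTC, sub_add_cancel]

end IsPropagator

end Propagator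

/-! ### Integrals over spheres and polar coordinates -/

section SphereAverage

variable {n : ℕ} {F : Type*} [NormedAddCommGroup F] [NormedSpace ℝ F]

/-- The integral of `g` over the sphere about `x` of radius `|t|` with respect to the pullback of
the surface measure of the unit sphere. -/
def unitSphereIntegral (g : EuclideanSpace ℝ (Fin n) → F) (x : EuclideanSpace ℝ (Fin n)) (t : ℝ) :
    F :=
  ∫ ζ : Metric.sphere (0 : EuclideanSpace ℝ (Fin n)) 1,
    g (x + t • (ζ : EuclideanSpace ℝ (Fin n)))
    ∂((volume : Measure (EuclideanSpace ℝ (Fin n))).toSphere)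

/-- The surface measure of the unit sphere, as a measure on the ambient space. -/
def sphereMeasure (n : ℕ) : Measure (EuclideanSpace ℝ (Fin n)) :=
  ((volume : Measure (EuclideanSpace ℝ (Fin n))).toSphere).map Subtype.val

instance : IsFiniteMeasure (sphereMeasure n) := by
  unfold sphereMeasure
  infer_instance

theorem ae_mem_sphere_sphereMeasure :
    ∀ᵐ v ∂(sphereMeasure n), v ∈ Metric.sphere (0 : EuclideanSpace ℝ (Fin n)) 1 := by
  exact (ae_map_iff measurable_subtype_coe.aemeasurable
    (p := fun v => v ∈ Metric.sphere (0 : EuclideanSpace ℝ (Fin n)) 1)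
    Metric.isClosed_sphere.measurableSet).2 (Filter.Eventually.of_forall fun ζ => ζ.2)

theorem integral_sphereMeasure {h : EuclideanSpace ℝ (Fin n) → F} :
    ∫ v, h v ∂(sphereMeasure n) = ∫ ζ : Metric.sphere (0 : EuclideanSpace ℝ (Fin n)) 1,
      h ζ ∂((volume : Measure (EuclideanSpace ℝ (Fin n))).toSphere) :=
  (MeasurableEmbedding.subtype_coe Metric.isClosed_sphere.measurableSet).integral_map _

theorem unitSphereIntegral_eq (g : EuclideanSpace ℝ (Fin n) → F) (x : EuclideanSpace ℝ (Fin n))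
    (t : ℝ) : unitSphereIntegral g x t = ∫ v, g (x + t • v) ∂(sphereMeasure n) :=
  (integral_sphereMeasure (h := fun v => g (x + t • v))).symm

theorem smoothOp_unitSphereIntegral [CompleteSpace F] :
    SmoothOp (unitSphereIntegral : (EuclideanSpace ℝ (Fin n) → F) → _ → ℝ → F) :=
  (SmoothOp.integral_translates (sphereMeasure n) (isCompact_sphere 0 1)
    ae_mem_sphere_sphereMeasure).congr fun g _ x t => unitSphereIntegral_eq g x t

/-- Antipodal invariance makes spherical integrals even in the signed radius, which carries
Darboux's equation to negative radii. -/
theorem map_neg_toSphere :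
    ((volume : Measure (EuclideanSpace ℝ (Fin n))).toSphere).map Neg.neg =
      (volume : Measure (EuclideanSpace ℝ (Fin n))).toSphere := by
  have hm : Measurable (Neg.neg : Metric.sphere (0 : EuclideanSpace ℝ (Fin n)) 1 → _) :=
    continuous_neg.measurable
  ext s hs
  rw [Measure.map_apply hm hs, Measure.toSphere_apply' _ hs, Measure.toSphere_apply' _ (hm hs)]
  congr 1
  rw [← Measure.measure_neg]
  congr 1
  ext y
  simp only [Set.mem_neg, Set.mem_smul, Set.mem_image, Set.mem_preimage]
  constructor
  · rintro ⟨r, hr, _, ⟨ζ, hζ, rfl⟩, h⟩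
    exact ⟨r, hr, _, ⟨-ζ, hζ, rfl⟩, by simp [h]⟩
  · rintro ⟨r, hr, _, ⟨ζ, hζ, rfl⟩, h⟩
    exact ⟨r, hr, _, ⟨-ζ, by simpa using hζ, rfl⟩, by simp [h]⟩

theorem unitSphereIntegral_neg (g : EuclideanSpace ℝ (Fin n) → F) (x : EuclideanSpace ℝ (Fin n))
    (t : ℝ) : unitSphereIntegral g x (-t) = unitSphereIntegral g x t := by
  have hm : MeasurableEmbedding
      (Neg.neg : Metric.sphere (0 : EuclideanSpace ℝ (Fin n)) 1 → _) :=
    (Homeomorph.neg (Metric.sphere (0 : EuclideanSpace ℝ (Fin n)) 1)).measurableEmbedding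
  rw [unitSphereIntegral, unitSphereIntegral]
  conv_lhs => rw [← map_neg_toSphere]
  rw [hm.integral_map]
  simp

theorem unitSphereIntegral_zero [CompleteSpace F] (g : EuclideanSpace ℝ (Fin n) → F)
    (x : EuclideanSpace ℝ (Fin n)) : unitSphereIntegral g x 0 =
      (n * (volume : Measure (EuclideanSpace ℝ (Fin n))).real (Metric.ball 0 1)) • g x := by
  simp [unitSphereIntegral]

/-- Integration in polar coordinates. -/
theorem integral_eq_integral_unitSphereIntegral [NeZero n] {f : EuclideanSpace ℝ (Fin n) → F}
    (hf : Integrable f) :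
    ∫ y, f y = ∫ r in Set.Ioi (0 : ℝ), r ^ (n - 1) • unitSphereIntegral f 0 r := by
  have : Nonempty (Fin n) := ⟨0⟩
  set μ : Measure (EuclideanSpace ℝ (Fin n)) := volume with hμ
  have hmp := μ.measurePreserving_homeomorphUnitSphereProd
  have hemb := (homeomorphUnitSphereProd (EuclideanSpace ℝ (Fin n))).measurableEmbedding
  set f' : Metric.sphere (0 : EuclideanSpace ℝ (Fin n)) 1 × Set.Ioi (0 : ℝ) → F :=
    fun p => f (p.2.1 • p.1.1) with hf'
  have hcomp : ∀ y : ({0}ᶜ : Set (EuclideanSpace ℝ (Fin n))),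
      f' (homeomorphUnitSphereProd _ y) = f y := by
    intro y
    have h := congrArg Subtype.val ((homeomorphUnitSphereProd _).symm_apply_apply y)
    rw [homeomorphUnitSphereProd_symm_apply_coe] at h
    rw [hf']
    exact congrArg f h
  have hint : Integrable f'
    (μ.toSphere.prod (.volumeIoiPow (Module.finrank ℝ (EuclideanSpace ℝ (Fin n)) - 1))) := by
    rw [← hmp.integrable_comp_emb hemb]
    have : f' ∘ homeomorphUnitSphereProd _ = f ∘ Subtype.val := funext hcomp
    rw [this, ← integrableOn_iff_comap_subtypeVal (measurableSet_singleton _).compl]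
    exact hf.integrableOn
  calc ∫ y, f y ∂μ = ∫ y : ({0}ᶜ : Set (EuclideanSpace ℝ (Fin n))), f y.1 ∂(μ.comap (↑)) := by
        rw [integral_subtype_comap (measurableSet_singleton _).compl, restrict_compl_singleton]
    _ = ∫ p, f' p ∂(μ.toSphere.prod
          (.volumeIoiPow (Module.finrank ℝ (EuclideanSpace ℝ (Fin n)) - 1))) := by
        rw [← hmp.integral_comp hemb]
        simp only [hcomp]
    _ = ∫ r : Set.Ioi (0 : ℝ), unitSphereIntegral f 0 r ∂(.volumeIoiPow (n - 1)) := by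
        rw [integral_prod_symm _ hint]
        simp [unitSphereIntegral, hf', hμ]
    _ = _ := by
        simp only [Measure.volumeIoiPow, ENNReal.ofReal]
        rw [integral_withDensity_eq_integral_smul,
          integral_subtype_comap measurableSet_Ioi
            fun a => Real.toNNReal (a ^ (n - 1)) • unitSphereIntegral f 0 a,
          setIntegral_congr_fun measurableSet_Ioi fun x hx => ?_]
        · rw [NNReal.smul_def, Real.coe_toNNReal _ (pow_nonneg hx.out.le _)]
        · exact (measurable_subtype_coe.pow_const _).real_toNNReal

theorem deriv_unitSphereIntegral [CompleteSpace F] {h : EuclideanSpace ℝ (Fin n) → F}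
    (hh : ContDiff ℝ ∞ h) (x : EuclideanSpace ℝ (Fin n)) (r : ℝ) :
    deriv (unitSphereIntegral h x) r =
      ∫ v, fderiv ℝ h (x + r • v) v ∂(sphereMeasure n) := by
  rw [funext (unitSphereIntegral_eq h x), deriv_integral_param (sphereMeasure n)
    (isCompact_sphere 0 1) ae_mem_sphere_sphereMeasure
    (H := fun p : ℝ × EuclideanSpace ℝ (Fin n) => h (x + p.1 • p.2)) (by fun_prop)]
  refine integral_congr_ae (Filter.Eventually.of_forall fun v => ?_)
  have h1 : HasDerivAt (fun s : ℝ => x + s • v) v r := by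
    simpa using ((hasDerivAt_id r).smul_const v).const_add x
  exact ((hh.differentiable (by simp) _).hasFDerivAt.comp_hasDerivAt r h1).deriv

end SphereAverage

/-! ### Darboux's equation for spherical means -/

section Darboux

variable {n : ℕ} {F : Type*} [NormedAddCommGroup F] [NormedSpace ℝ F]

/-- The support of `ψ` avoids `0`, so the singularity of the square root is not seen. Writing the
radial cutoff as `χ (‖y‖²)` then avoids differentiating the norm. -/
theorem contDiff_comp_sqrt {ψ : ℝ → ℝ} (hψ : ContDiff ℝ ∞ ψ)
    (hs : tsupport ψ ⊆ Set.Ioi 0) : ContDiff ℝ ∞ (fun u => ψ (Real.sqrt u)) := by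
  rw [contDiff_iff_contDiffAt]
  intro u
  rcases lt_or_ge 0 u with hu | hu
  · exact hψ.contDiffAt.comp u (Real.contDiffAt_sqrt hu.ne')
  · have h0 : (0 : ℝ) ∉ tsupport ψ := fun h => lt_irrefl (0 : ℝ) (hs h)
    have h1 : ∀ᶠ r in nhds (0 : ℝ), ψ r = 0 := by
      filter_upwards [(isClosed_tsupport ψ).isOpen_compl.mem_nhds h0] with r hr
      exact image_eq_zero_of_notMem_tsupport hr
    have h2 : Filter.Tendsto Real.sqrt (nhds u) (nhds 0) := by
      simpa [Real.sqrt_eq_zero_of_nonpos hu] using Real.continuous_sqrt.tendsto u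
    exact contDiffAt_const.congr_of_eventuallyEq (h2.eventually h1)

theorem hasCompactSupport_comp_sq_norm {χ : ℝ → ℝ} (hc : HasCompactSupport χ) :
    HasCompactSupport (fun y : EuclideanSpace ℝ (Fin n) => χ (‖y‖ ^ 2)) := by
  obtain ⟨R, hR⟩ := hc.isCompact.isBounded.subset_closedBall 0
  refine HasCompactSupport.intro (isCompact_closedBall (0 : EuclideanSpace ℝ (Fin n)) (R + 1))
    fun y hy => image_eq_zero_of_notMem_tsupport fun h => hy ?_
  have h1 := hR h
  simp only [Metric.mem_closedBall, dist_zero_right, Real.norm_eq_abs, abs_pow, abs_norm] at h1 ⊢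
  nlinarith [norm_nonneg y]

theorem fderiv_comp_sq_norm {χ : ℝ → ℝ} (hχ : ContDiff ℝ ∞ χ) (y e : EuclideanSpace ℝ (Fin n)) :
    fderiv ℝ (fun y : EuclideanSpace ℝ (Fin n) => χ (‖y‖ ^ 2)) y e =
      2 * deriv χ (‖y‖ ^ 2) * inner ℝ y e := by
  have h1 := (hχ.differentiable (by simp) (‖y‖ ^ 2)).hasDerivAt.hasFDerivAt.comp y
    (hasStrictFDerivAt_norm_sq y).hasFDerivAt
  rw [show (fun y : EuclideanSpace ℝ (Fin n) => χ (‖y‖ ^ 2)) = χ ∘ fun y => ‖y‖ ^ 2 from rfl,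
    h1.fderiv]
  simp
  ring

/-- Green's formula for a radial cutoff. -/
theorem integral_radial_smul_laplacian {h : EuclideanSpace ℝ (Fin n) → F} (hh : ContDiff ℝ ∞ h)
    {χ : ℝ → ℝ} (hχ : ContDiff ℝ ∞ χ) (hc : HasCompactSupport χ) :
    ∫ y, χ (‖y‖ ^ 2) • Laplacian.laplacian h y =
      - ∫ y, (2 * deriv χ (‖y‖ ^ 2)) • fderiv ℝ h y y := by
  set Φ : EuclideanSpace ℝ (Fin n) → ℝ := fun y => χ (‖y‖ ^ 2) with hΦ
  have hΦs : ContDiff ℝ ∞ Φ := hχ.comp (contDiff_norm_sq ℝ)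
  have hΦc : HasCompactSupport Φ := hasCompactSupport_comp_sq_norm hc
  set e := EuclideanSpace.basisFun (Fin n) ℝ with he
  have hΦ'c : ∀ v, HasCompactSupport (fun y => fderiv ℝ Φ y v) := fun v => hΦc.fderiv_apply ℝ v
  have hΦ's : ∀ v, Continuous (fun y => fderiv ℝ Φ y v) := fun v =>
    (contDiff_fderiv_apply hΦs v).continuous
  have hd := fun v => contDiff_fderiv_apply hh v
  have hdd := fun v w => contDiff_fderiv_apply (hd v) w
  have i1 : ∀ i, Integrable (fun y => Φ y • fderiv ℝ (fun z => fderiv ℝ h z (e i)) y (e i)) :=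
    fun i => (hΦs.continuous.smul (hdd _ _).continuous).integrable_of_hasCompactSupport
    hΦc.smul_right
  have i2 : ∀ i, Integrable (fun y => fderiv ℝ Φ y (e i) • fderiv ℝ h y (e i)) :=
    fun i => ((hΦ's _).smul (hd _).continuous).integrable_of_hasCompactSupport (hΦ'c _).smul_right
  have i3 : ∀ i, Integrable (fun y => Φ y • fderiv ℝ h y (e i)) :=
    fun i => (hΦs.continuous.smul (hd _).continuous).integrable_of_hasCompactSupport hΦc.smul_right
  calc ∫ y, Φ y • Laplacian.laplacian h y
      = ∑ i, ∫ y, Φ y • fderiv ℝ (fun z => fderiv ℝ h z (e i)) y (e i) := by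
        rw [← integral_finsetSum _ fun i _ => i1 i]
        simp only [laplacian_eq_sum_fderiv_fderiv hh, smul_sum, he]
    _ = ∑ i, - ∫ y, fderiv ℝ Φ y (e i) • fderiv ℝ h y (e i) := sum_congr rfl fun i _ =>
        integral_smul_fderiv_eq_neg_fderiv_smul_of_integrable (i2 i) (i1 i) (i3 i)
          (fun y _ => hΦs.differentiable (by simp) y) (fun y _ => (hd _).differentiable (by simp) y)
    _ = _ := by
        rw [sum_neg_distrib, ← integral_finsetSum _ fun i _ => i2 i]
        congr 2
        ext y
        have hy := (congrArg (fderiv ℝ h y) (e.sum_repr y)).symm.trans (map_sum _ _ _)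
        rw [hy, smul_sum]
        refine sum_congr rfl fun i _ => ?_
        rw [hΦ, fderiv_comp_sq_norm hχ, map_smul, smul_smul, e.repr_apply_apply, real_inner_comm]

theorem integral_Ioi_smul_eq {ψ : ℝ → ℝ} (hs : tsupport ψ ⊆ Set.Ioi 0) (K : ℝ → F) :
    ∫ r in Set.Ioi (0 : ℝ), ψ r • K r = ∫ r, ψ r • K r := by
  refine setIntegral_eq_integral_of_forall_compl_eq_zero fun r hr => ?_
  rw [image_eq_zero_of_notMem_tsupport fun h => hr (hs h), zero_smul]

theorem unitSphereIntegral_smul_radial (c : ℝ → ℝ) (h : EuclideanSpace ℝ (Fin n) → F) (r : ℝ) :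
    unitSphereIntegral (fun y => c ‖y‖ • h y) 0 r = c |r| • unitSphereIntegral h 0 r := by
  rw [unitSphereIntegral, unitSphereIntegral, ← integral_smul]
  refine integral_congr_ae (Filter.Eventually.of_forall fun ζ => ?_)
  simp [norm_smul]

variable [CompleteSpace F]

/-- Testing `Δ h` against a radial cutoff, Green's formula and polar coordinates on both sides
reduce to one integration by parts in the radius. This is the divergence form `r^{n-1} B = (r^{n-1}
A')'` tested against `ψ`. -/
theorem darboux_weak [NeZero n] {h : EuclideanSpace ℝ (Fin n) → F} (hh : ContDiff ℝ ∞ h)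
    {ψ : ℝ → ℝ} (hψ : ContDiff ℝ ∞ ψ) (hc : HasCompactSupport ψ) (hs : tsupport ψ ⊆ Set.Ioi 0) :
    ∫ r, ψ r • (r ^ (n - 1) • unitSphereIntegral (Laplacian.laplacian h) 0 r -
      deriv (fun r => r ^ (n - 1) • deriv (unitSphereIntegral h 0) r) r) = 0 := by
  set χ : ℝ → ℝ := fun u => ψ (Real.sqrt u) with hχdef
  have hχ : ContDiff ℝ ∞ χ := contDiff_comp_sqrt hψ hs
  have hχc : HasCompactSupport χ := by
    obtain ⟨R, hR⟩ := hc.isCompact.isBounded.subset_closedBall 0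
    refine HasCompactSupport.intro (isCompact_Icc (a := (0 : ℝ)) (b := R ^ 2)) fun u hu =>
      image_eq_zero_of_notMem_tsupport (f := ψ) (x := Real.sqrt u) fun h => hu ?_
    have h1 : 0 < Real.sqrt u := hs h
    have h2 := hR h
    rw [Metric.mem_closedBall, dist_zero_right, Real.norm_eq_abs, abs_of_pos h1] at h2
    exact ⟨(Real.sqrt_pos.1 h1).le, (Real.sqrt_le_left (h1.le.trans h2)).1 h2⟩
  have hA : ContDiff ℝ ∞ (unitSphereIntegral h 0) :=
    smoothOp_unitSphereIntegral.contDiff_right hh 0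
  have hL : ContDiff ℝ ∞ (unitSphereIntegral (Laplacian.laplacian h) 0) :=
    smoothOp_unitSphereIntegral.contDiff_right (contDiff_laplacian hh) 0
  have hA' : ContDiff ℝ ∞ (deriv (unitSphereIntegral h 0)) := by
    simpa using (contDiff_infty_iff_deriv.1 hA).2
  set K : ℝ → F := fun r => r ^ (n - 1) • deriv (unitSphereIntegral h 0) r with hK
  have hKs : ContDiff ℝ ∞ K := (contDiff_id.pow _).smul hA'
  have hK's : ContDiff ℝ ∞ (deriv K) := (contDiff_infty_iff_deriv.1 hKs).2
  have hψ' : Continuous (deriv ψ) := hψ.continuous_deriv (by simp)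
  have hs' : tsupport (deriv ψ) ⊆ Set.Ioi 0 := Set.Subset.trans tsupport_deriv_subset hs
  have hG := integral_radial_smul_laplacian hh hχ hχc
  have hLHS : ∫ y, χ (‖y‖ ^ 2) • Laplacian.laplacian h y =
      ∫ r, ψ r • (r ^ (n - 1) • unitSphereIntegral (Laplacian.laplacian h) 0 r) := by
    rw [integral_eq_integral_unitSphereIntegral, ← integral_Ioi_smul_eq hs]
    · refine setIntegral_congr_fun measurableSet_Ioi fun r hr => ?_
      have hr' : 0 < r := hr
      rw [unitSphereIntegral_smul_radial (fun s => χ (s ^ 2)), smul_comm]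
      simp [hχdef, abs_of_pos hr', Real.sqrt_sq hr'.le]
    · exact ((hχ.continuous.comp (by fun_prop)).smul
        (contDiff_laplacian hh).continuous).integrable_of_hasCompactSupport
        (hasCompactSupport_comp_sq_norm hχc).smul_right
  have hRHS : ∫ y, (2 * deriv χ (‖y‖ ^ 2)) • fderiv ℝ h y y = ∫ r, deriv ψ r • K r := by
    rw [integral_eq_integral_unitSphereIntegral, ← integral_Ioi_smul_eq hs']
    · refine setIntegral_congr_fun measurableSet_Ioi fun r hr => ?_
      have hr' : 0 < r := hr
      have hd : deriv ψ r = 2 * r * deriv χ (r ^ 2) := by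
        have h1 : HasDerivAt (fun r => χ (r ^ 2)) (deriv χ (r ^ 2) * (2 * r)) r := by
          have := (hχ.differentiable (by simp) (r ^ 2)).hasDerivAt.comp r (hasDerivAt_pow 2 r)
          simpa [Function.comp_def] using this
        have h2 : ψ =ᶠ[nhds r] fun r => χ (r ^ 2) := by
          filter_upwards [lt_mem_nhds hr'] with s hs
          simp [hχdef, Real.sqrt_sq hs.le]
        rw [h2.deriv_eq, h1.deriv]
        ring
      have hKr : K r = r ^ (n - 1) • deriv (unitSphereIntegral h 0) r := rfl
      rw [unitSphereIntegral_smul_radial (fun s => 2 * deriv χ (s ^ 2)), hKr, hd,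
        abs_of_pos hr', deriv_unitSphereIntegral hh, unitSphereIntegral_eq]
      simp only [zero_add, map_smul]
      rw [integral_smul, smul_smul, smul_smul, smul_smul]
      congr 1
      ring
    · refine Continuous.integrable_of_hasCompactSupport ?_ ?_
      · exact ((continuous_const.mul ((hχ.continuous_deriv (by simp)).comp (by fun_prop)))).smul
          ((hh.continuous_fderiv (by simp)).clm_apply continuous_id)
      · exact (HasCompactSupport.mul_left
          (hasCompactSupport_comp_sq_norm hχc.deriv)).smul_right
  have hIBP : ∫ r, ψ r • deriv K r = - ∫ r, deriv ψ r • K r := by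
    simp only [← fderiv_apply_one_eq_deriv]
    refine integral_smul_fderiv_eq_neg_fderiv_smul_of_integrable ?_ ?_ ?_
      (fun y _ => hψ.differentiable (by simp) y) (fun y _ => hKs.differentiable (by simp) y)
    · simp only [fderiv_apply_one_eq_deriv]
      exact (hψ'.smul hKs.continuous).integrable_of_hasCompactSupport hc.deriv.smul_right
    · simp only [fderiv_apply_one_eq_deriv]
      exact (hψ.continuous.smul hK's.continuous).integrable_of_hasCompactSupport hc.smul_right
    · exact (hψ.continuous.smul hKs.continuous).integrable_of_hasCompactSupport hc.smul_right
  simp only [smul_sub]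
  rw [integral_sub, ← hLHS, hG, hRHS, hIBP, sub_self]
  · exact (hψ.continuous.smul ((continuous_pow _).smul
      hL.continuous)).integrable_of_hasCompactSupport hc.smul_right
  · exact (hψ.continuous.smul hK's.continuous).integrable_of_hasCompactSupport hc.smul_right

/-- The Euler–Poisson–Darboux equation for spherical means. -/
theorem darboux (hn : 2 ≤ n) {g : EuclideanSpace ℝ (Fin n) → F} (hg : ContDiff ℝ ∞ g)
    (x : EuclideanSpace ℝ (Fin n)) (r : ℝ) :
    r • deriv (deriv (unitSphereIntegral g x)) r +
        ((n : ℝ) - 1) • deriv (unitSphereIntegral g x) r =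
      r • unitSphereIntegral (Laplacian.laplacian g) x r := by
  have : NeZero n := ⟨by omega⟩
  wlog hx : x = 0 generalizing x g
  · have hop := smoothOp_unitSphereIntegral (n := n) (F := F)
    have h := this (g := fun y => g (y + x)) (by fun_prop) 0 rfl
    have h1 : unitSphereIntegral (fun y => g (y + x)) 0 = unitSphereIntegral g x := by
      ext t
      rw [hop.translate g hg, zero_add]
    have h2 : unitSphereIntegral (Laplacian.laplacian fun y => g (y + x)) 0 =
        unitSphereIntegral (Laplacian.laplacian g) x := by
      ext t
      rw [hop.comp_laplacian.translate g hg, zero_add]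
    rwa [h1, h2] at h
  subst hx
  set A := unitSphereIntegral g 0 with hAdef
  set B := unitSphereIntegral (Laplacian.laplacian g) 0 with hBdef
  have hA : ContDiff ℝ ∞ A := smoothOp_unitSphereIntegral.contDiff_right hg 0
  have hB : ContDiff ℝ ∞ B :=
    smoothOp_unitSphereIntegral.contDiff_right (contDiff_laplacian hg) 0
  have hA' : ContDiff ℝ ∞ (deriv A) := (contDiff_infty_iff_deriv.1 hA).2
  have hA'' : ContDiff ℝ ∞ (deriv (deriv A)) := (contDiff_infty_iff_deriv.1 hA').2
  have hdK : ∀ r, deriv (fun r => r ^ (n - 1) • deriv A r) r =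
      r ^ (n - 1) • deriv (deriv A) r + (((n : ℝ) - 1) * r ^ (n - 2)) • deriv A r := by
    intro r
    have h1 := ((hasDerivAt_pow (n - 1) r).smul
      (hA'.differentiable (by simp) r).hasDerivAt).deriv
    have h2 : ((n - 1 : ℕ) : ℝ) = (n : ℝ) - 1 := by rw [Nat.cast_sub (by omega)]; simp
    rw [h2, show n - 1 - 1 = n - 2 by omega] at h1
    exact h1
  set q : ℝ → F := fun r => r ^ (n - 1) • B r -
    deriv (fun r => r ^ (n - 1) • deriv A r) r with hq
  have hqc : Continuous q := by
    simp only [hq, hdK]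
    have := hA'.continuous
    have := hA''.continuous
    have := hB.continuous
    fun_prop
  have hpos : ∀ r, 0 < r → r • deriv (deriv A) r + ((n : ℝ) - 1) • deriv A r = r • B r := by
    -- The weak identity holds almost everywhere on the half-line by the fundamental lemma of the
    -- calculus of variations, and everywhere there by continuity.
    have hae := isOpen_Ioi.ae_eq_zero_of_integral_contDiff_smul_eq_zero (μ := volume)
      (hqc.locallyIntegrable.locallyIntegrableOn (Set.Ioi 0))
      fun ψ h1 h2 h3 => darboux_weak hg h1 h2 h3
    have heq : Set.EqOn q (fun _ => 0) (Set.Ioi 0) :=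
      Measure.eqOn_open_of_ae_eq ((ae_restrict_iff' measurableSet_Ioi).2 hae) isOpen_Ioi
        hqc.continuousOn continuousOn_const
    intro r hr
    have h := heq hr
    simp only [hq, hdK] at h
    rw [sub_eq_zero, show n - 1 = n - 2 + 1 by omega] at h
    have h' : r ^ (n - 2) • (r • deriv (deriv A) r + ((n : ℝ) - 1) • deriv A r) =
        r ^ (n - 2) • (r • B r) := by
      rw [smul_add, smul_smul, smul_smul, smul_smul, ← pow_succ, h, mul_comm (r ^ (n - 2))]
    exact smul_right_injective F (pow_pos hr _).ne' h'
  -- Parity transfers the equation to `r < 0` and gives `A'(0) = 0`, which is all the equation says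
  -- at `r = 0`.
  have heven : ∀ r, A (-r) = A r := unitSphereIntegral_neg g 0
  have hodd : ∀ r, deriv A (-r) = - deriv A r := fun r => by
    have h := deriv_comp_neg A r
    rw [funext heven] at h
    rw [h, neg_neg]
  have heven2 : ∀ r, deriv (deriv A) (-r) = deriv (deriv A) r := fun r => by
    have h := deriv_comp_neg (deriv A) r
    rw [funext hodd] at h
    have h2 : deriv (fun r => -deriv A r) r = -deriv (deriv A) r := deriv.fun_neg
    rw [h2] at h
    exact (neg_injective h).symm
  rcases lt_trichotomy r 0 with hr | rfl | hr
  · have h := hpos (-r) (by linarith)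
    rw [heven2, hodd, hBdef, unitSphereIntegral_neg] at h
    rw [hBdef]
    simp only [neg_smul, smul_neg, ← neg_add] at h
    exact neg_injective h
  · have h := hodd 0
    rw [neg_zero, eq_neg_iff_add_eq_zero, ← two_smul ℝ, smul_eq_zero] at h
    simp [h.resolve_left two_ne_zero]
  · exact hpos r hr

end Darboux

/-! ### The weighted primitive and Euler–Poisson–Darboux equations -/

section WeightedPrimitive

variable {E : Type} [NormedAddCommGroup E] [NormedSpace ℝ E] [FiniteDimensional ℝ E]
  {F : Type*} [NormedAddCommGroup F] [NormedSpace ℝ F] [CompleteSpace F]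

theorem hasDerivAt_weightedPrimitive {h : ℝ → F} (hh : Continuous h) (t : ℝ) :
    HasDerivAt (weightedPrimitive h) (t • h t) t := by
  have hc : Continuous fun s : ℝ => s • h s := continuous_id.smul hh
  exact intervalIntegral.integral_hasDerivAt_right (hc.intervalIntegrable 0 t)
    hc.stronglyMeasurable.stronglyMeasurableAtFilter hc.continuousAt

omit [CompleteSpace F] in
theorem weightedPrimitive_zero (h : ℝ → F) : weightedPrimitive h 0 = 0 := by
  simp [weightedPrimitive]

theorem SmoothOp.weightedPrimitive {T : (E → F) → E → ℝ → F} (hT : SmoothOp T) :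
    SmoothOp (fun g x t => weightedPrimitive (T g x) t) :=
  (hT.smul_fun contDiff_id).prim

theorem SmoothOp.weightedPrimitive_iterate {T : (E → F) → E → ℝ → F} (hT : SmoothOp T) (k : ℕ) :
    SmoothOp (fun g x t => (HigherOrderCauchy.weightedPrimitive^[k] (T g x)) t) := by
  induction k with
  | zero => exact hT
  | succ k ih =>
    simp only [Function.iterate_succ_apply']
    exact ih.weightedPrimitive

omit [CompleteSpace F] in
theorem hasDerivAt_smul_id {h : ℝ → F} {t : ℝ} (hh : DifferentiableAt ℝ h t) :
    HasDerivAt (fun t : ℝ => t • h t) (t • deriv h t + h t) t := by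
  have h1 := (hasDerivAt_id t).smul hh.hasDerivAt
  rw [id, one_smul] at h1
  exact h1

/-- The effect of the weighted primitive on the equation `t h'' + 2 p h' = t q`. -/
theorem weightedPrimitive_epd {h q : ℝ → F} (hh : ContDiff ℝ ∞ h) (hq : Continuous q) {p : ℝ}
    (heq : ∀ t, t • deriv (deriv h) t + (2 * p) • deriv h t = t • q t) (t : ℝ) :
    t • deriv (deriv (weightedPrimitive h)) t +
        (2 * (p - 1)) • deriv (weightedPrimitive h) t =
      t • (weightedPrimitive q t + (2 * p - 1) • h 0) := by
  have hh' : ContDiff ℝ ∞ (deriv h) := (contDiff_infty_iff_deriv.1 hh).2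
  have hd := fun t => (hh.differentiable (by simp) t).hasDerivAt
  have hd' := fun t => (hh'.differentiable (by simp) t).hasDerivAt
  have h1 : deriv (weightedPrimitive h) = fun t => t • h t :=
    funext fun t => (hasDerivAt_weightedPrimitive hh.continuous t).deriv
  have h2 := (hasDerivAt_smul_id (hd t).differentiableAt).deriv
  -- By the equation, `s q = s h'' + 2p h'` is the derivative of `(2p-1) h + s h'`.
  have h3 : weightedPrimitive q t = ((2 * p - 1) • h t + t • deriv h t) - (2 * p - 1) • h 0 := by
    have h4 : ∀ s ∈ Set.uIcc 0 t, HasDerivAt (fun s => (2 * p - 1) • h s + s • deriv h s)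
        (s • q s) s := by
      intro s _
      refine (((hd s).const_smul (2 * p - 1)).add ((hasDerivAt_id s).smul (hd' s))).congr_deriv ?_
      rw [← heq, id, one_smul]
      module
    rw [weightedPrimitive, intervalIntegral.integral_eq_sub_of_hasDerivAt h4
      ((continuous_id.smul hq).intervalIntegrable 0 t)]
    simp
  rw [h1, h2, h3]
  module

omit [CompleteSpace F] in
theorem weightedPrimitive_const_smul (c : ℝ) (h : ℝ → F) (t : ℝ) :
    weightedPrimitive (fun s => c • h s) t = c • weightedPrimitive h t := by
  simp only [weightedPrimitive, smul_comm _ c]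
  exact intervalIntegral.integral_smul _ _

omit [CompleteSpace F] in
theorem weightedPrimitive_add {h k : ℝ → F} (hh : Continuous h) (hk : Continuous k) (t : ℝ) :
    weightedPrimitive (fun s => h s + k s) t = weightedPrimitive h t + weightedPrimitive k t := by
  simp only [weightedPrimitive, smul_add]
  exact intervalIntegral.integral_add ((continuous_id.smul hh).intervalIntegrable _ _)
    ((continuous_id.smul hk).intervalIntegrable _ _)

theorem weightedPrimitive_pow_smul (k : ℕ) (c : ℝ) (v : F) (t : ℝ) :
    weightedPrimitive (fun s => (c * s ^ k) • v) t = (c * t ^ (k + 2) / (k + 2)) • v := by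
  have h : (fun s : ℝ => s • (c * s ^ k) • v) = fun s => (c * s ^ (k + 1)) • v := by
    ext s
    rw [smul_smul]
    ring_nf
  rw [weightedPrimitive, h, intervalIntegral.integral_smul_const]
  congr 1
  simp
  ring

end WeightedPrimitive

/-! ### From spherical means towards the wave equation -/

section Wave

variable {n : ℕ} {F : Type*} [NormedAddCommGroup F] [NormedSpace ℝ F]

/-- The smooth part of the spherical mean entering `bracket`. -/
def scaledMean (ν : ℕ) (a : ℝ) (g : EuclideanSpace ℝ (Fin n) → F) (x : EuclideanSpace ℝ (Fin n))
    (t : ℝ) : F :=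
  ((a ^ 2) ^ ν * (2 * (2 * Real.pi) ^ (ν + 1))⁻¹) • unitSphereIntegral (lapPow ν g) x (a * t)

/-- The polynomial part of `bracket`. -/
def taylorPart (ν : ℕ) (a : ℝ) (g : EuclideanSpace ℝ (Fin n) → F) (x : EuclideanSpace ℝ (Fin n))
    (t : ℝ) : F :=
  ∑ l ∈ range ν, (a ^ (2 * l) * t ^ (2 * l + 1) / ((2 * l + 1).factorial : ℝ)) • lapPow l g x

/-- The solution of the wave equation of speed `a` with data `0, g`. -/
def waveOp (ν : ℕ) (a : ℝ) (g : EuclideanSpace ℝ (Fin n) → F) (x : EuclideanSpace ℝ (Fin n))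
    (t : ℝ) : F :=
  t • (weightedPrimitive^[ν] (scaledMean ν a g x)) t + taylorPart ν a g x t

theorem smoothOp_taylorPart (ν : ℕ) (a : ℝ) :
    SmoothOp (taylorPart ν a : (EuclideanSpace ℝ (Fin n) → F) → _) :=
  SmoothOp.sum (range ν) fun l _ => (smoothOp_lapPow l).smul_fun
    (c := fun t => a ^ (2 * l) * t ^ (2 * l + 1) / ((2 * l + 1).factorial : ℝ)) (by fun_prop)

variable [CompleteSpace F]

theorem smoothOp_scaledMean (ν : ℕ) (a : ℝ) :
    SmoothOp (scaledMean ν a : (EuclideanSpace ℝ (Fin n) → F) → _) :=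
  ((smoothOp_unitSphereIntegral.comp_lapPow ν).comp_mul a).const_smul _

theorem smoothOp_waveOp (ν : ℕ) (a : ℝ) :
    SmoothOp (waveOp ν a : (EuclideanSpace ℝ (Fin n) → F) → _) :=
  (((smoothOp_scaledMean ν a).weightedPrimitive_iterate ν).smul_fun contDiff_id).fun_add
    (smoothOp_taylorPart ν a)

/-- The constant `2 (2π)^{ν+1}` is the area of the unit sphere divided by `(2ν+1)!!`, so the symbol
`S` is not the area itself once `ν > 0`. The double factorial is later absorbed by the iterated
primitives. -/
theorem sphere_normalization {ν : ℕ} (hn : n = 2 * ν + 3) :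
    (2 * (2 * Real.pi) ^ (ν + 1))⁻¹ *
      (n * (volume : Measure (EuclideanSpace ℝ (Fin n))).real (Metric.ball 0 1)) =
      ((2 * ν + 1).doubleFactorial : ℝ)⁻¹ := by
  have hd : Module.finrank ℝ (EuclideanSpace ℝ (Fin n)) = 2 * (ν + 1) + 1 := by
    rw [finrank_euclideanSpace_fin, hn]
    ring
  have hpos : Nonempty (Fin n) := ⟨⟨0, by omega⟩⟩
  rw [Measure.real, InnerProductSpace.volume_ball_of_dim_odd hd]
  have h1 : ((2 * (ν + 1) + 1).doubleFactorial : ℝ) =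
      (2 * ν + 3) * ((2 * ν + 1).doubleFactorial : ℝ) := by
    rw [show 2 * (ν + 1) + 1 = 2 * ν + 1 + 2 by ring, Nat.doubleFactorial_add_two]
    push_cast
    ring
  have h2 : ((2 * ν + 1).doubleFactorial : ℝ) ≠ 0 := by
    exact_mod_cast (Nat.doubleFactorial_pos _).ne'
  have h3 : (n : ℝ) = 2 * ν + 3 := by
    rw [hn]
    push_cast
    ring
  rw [ENNReal.toReal_mul, ENNReal.toReal_ofReal (by positivity), hd, h1, h3]
  simp only [ENNReal.ofReal_one, one_pow, ENNReal.toReal_one, one_mul]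
  have h4 := Real.pi_pos
  have h5 : (2 * (ν : ℝ) + 3) ≠ 0 := by positivity
  field_simp
  ring

theorem scaledMean_zero {ν : ℕ} (hn : n = 2 * ν + 3) (a : ℝ) (g : EuclideanSpace ℝ (Fin n) → F)
    (x : EuclideanSpace ℝ (Fin n)) : scaledMean ν a g x 0 =
      ((a ^ 2) ^ ν * ((2 * ν + 1).doubleFactorial : ℝ)⁻¹) • lapPow ν g x := by
  rw [scaledMean, mul_zero, unitSphereIntegral_zero, smul_smul, mul_assoc, sphere_normalization hn]

theorem scaledMean_epd {ν : ℕ} (hn : n = 2 * ν + 3) (a : ℝ) {g : EuclideanSpace ℝ (Fin n) → F}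
    (hg : ContDiff ℝ ∞ g) (x : EuclideanSpace ℝ (Fin n)) (t : ℝ) :
    t • deriv (deriv (scaledMean ν a g x)) t +
        (2 * ((ν : ℝ) + 1)) • deriv (scaledMean ν a g x) t =
      t • a ^ 2 • scaledMean ν a (Laplacian.laplacian g) x t := by
  set c : ℝ := (a ^ 2) ^ ν * (2 * (2 * Real.pi) ^ (ν + 1))⁻¹ with hc
  set A := unitSphereIntegral (lapPow ν g) x with hA
  have h1 : deriv (scaledMean ν a g x) = fun t => c • a • deriv A (a * t) := by
    ext t
    change deriv (fun t => c • A (a * t)) t = _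
    rw [deriv_fun_const_smul_field, deriv_comp_mul_left]
  have h2 : deriv (fun t => c • a • deriv A (a * t)) t = c • a • a • deriv (deriv A) (a * t) := by
    rw [deriv_fun_const_smul_field, deriv_fun_const_smul_field, deriv_comp_mul_left]
  have hD := darboux (by omega) (contDiff_lapPow ν hg) x (a * t)
  rw [← lapPow_succ', lapPow_succ] at hD
  have h3 : (n : ℝ) - 1 = 2 * ((ν : ℝ) + 1) := by
    rw [hn]
    push_cast
    ring
  rw [h3] at hD
  rw [h1, h2, scaledMean, ← hc]
  -- Darboux's equation at radius `a t` is multiplied by `c a` rather than divided by `a`, so `a =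
  -- 0` needs no separate treatment.
  have h4 := congrArg (fun v => (c * a) • v) hD
  simp only [smul_add, smul_smul] at h4 ⊢
  convert h4 using 2
  · congr 1
    ring
  · congr 1
    ring
  · ring

/-- Only the first primitive leaves a boundary value, with factor `2p - 1 = 2ν + 1`, because later
iterates vanish at `0`. That constant is then integrated `i` times against `s ds`, which gives
`t^{2i} / (2^i i!)`. -/
theorem weightedPrimitive_iterate_scaledMean_epd {ν : ℕ} (hn : n = 2 * ν + 3) (a : ℝ)
    {g : EuclideanSpace ℝ (Fin n) → F} (hg : ContDiff ℝ ∞ g) (x : EuclideanSpace ℝ (Fin n))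
    (i : ℕ) (t : ℝ) :
    t • deriv (deriv (weightedPrimitive^[i + 1] (scaledMean ν a g x))) t +
        (2 * ((ν : ℝ) - i)) • deriv (weightedPrimitive^[i + 1] (scaledMean ν a g x)) t =
      t • (a ^ 2 • (weightedPrimitive^[i + 1] (scaledMean ν a (Laplacian.laplacian g) x)) t +
        ((2 * ν + 1) / (2 ^ i * i.factorial) * t ^ (2 * i)) • scaledMean ν a g x 0) := by
  have hs : ∀ k, ContDiff ℝ ∞ (weightedPrimitive^[k] (scaledMean ν a g x)) := fun k =>
    ((smoothOp_scaledMean ν a).weightedPrimitive_iterate k).contDiff_right hg x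
  have hs' : ∀ k, Continuous (fun t => a ^ 2 •
      (weightedPrimitive^[k] (scaledMean ν a (Laplacian.laplacian g) x)) t) := fun k =>
    ((((smoothOp_scaledMean ν a).weightedPrimitive_iterate k).contDiff_right
      (contDiff_laplacian hg) x).continuous).const_smul (a ^ 2)
  induction i generalizing t with
  | zero =>
    have h := weightedPrimitive_epd (hs 0) (hs' 0)
      (fun t => scaledMean_epd hn a hg x t) t
    simp only [Function.iterate_zero, id, zero_add, Function.iterate_one, Nat.cast_zero,
      sub_zero] at h ⊢
    rw [show (ν : ℝ) = ν + 1 - 1 by ring, h, weightedPrimitive_const_smul]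
    congr 3
    simp
    ring
  | succ i ih =>
    have hc2 : Continuous fun t : ℝ =>
        ((2 * ν + 1) / (2 ^ i * i.factorial) * t ^ (2 * i)) • scaledMean ν a g x 0 := by fun_prop
    have h := weightedPrimitive_epd (q := fun t => a ^ 2 • (weightedPrimitive^[i + 1]
        (scaledMean ν a (Laplacian.laplacian g) x)) t +
      ((2 * ν + 1) / (2 ^ i * i.factorial) * t ^ (2 * i)) • scaledMean ν a g x 0)
      (hs (i + 1)) ((hs' (i + 1)).add hc2) ih t
    have h0 : (weightedPrimitive^[i + 1] (scaledMean ν a g x)) 0 = 0 := by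
      rw [Function.iterate_succ_apply', weightedPrimitive_zero]
    rw [h0, smul_zero, add_zero,
      weightedPrimitive_add (hs' (i + 1)) hc2,
      weightedPrimitive_const_smul, weightedPrimitive_pow_smul] at h
    rw [Function.iterate_succ_apply' _ (i + 1), Function.iterate_succ_apply' _ (i + 1),
      show (ν : ℝ) - (i + 1 : ℕ) = ν - i - 1 by push_cast; ring, h]
    congr 3
    rw [Nat.factorial_succ]
    push_cast
    have : (i.factorial : ℝ) ≠ 0 := by exact_mod_cast i.factorial_ne_zero
    field_simp
    ring

omit [CompleteSpace F] in
theorem deriv_deriv_smul_id {h : ℝ → F} (hh : ContDiff ℝ ∞ h) (t : ℝ) :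
    deriv (deriv fun t : ℝ => t • h t) t = t • deriv (deriv h) t + (2 : ℝ) • deriv h t := by
  have hh' : ContDiff ℝ ∞ (deriv h) := (contDiff_infty_iff_deriv.1 hh).2
  have h1 : deriv (fun t : ℝ => t • h t) = fun t => t • deriv h t + h t := by
    ext t
    exact (hasDerivAt_smul_id (hh.differentiable (by simp) t)).deriv
  rw [h1]
  refine ((hasDerivAt_smul_id (hh'.differentiable (by simp) t)).add
    (hh.differentiable (by simp) t).hasDerivAt).deriv.trans ?_
  module

theorem hasDerivAt_pow_div_factorial (k : ℕ) (t : ℝ) :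
    HasDerivAt (fun t : ℝ => t ^ (k + 1) / ((k + 1).factorial : ℝ)) (t ^ k / (k.factorial : ℝ)) t
    := by
  refine ((hasDerivAt_pow (k + 1) t).div_const _).congr_deriv ?_
  rw [Nat.factorial_succ]
  push_cast
  have : (k.factorial : ℝ) ≠ 0 := by exact_mod_cast k.factorial_ne_zero
  field_simp

end Wave

/-! ### The wave equation of speed `a` -/

section WaveEquation

variable {n : ℕ} {F : Type*} [NormedAddCommGroup F] [NormedSpace ℝ F]

theorem taylorPart_succ (ν : ℕ) (a : ℝ) (g : EuclideanSpace ℝ (Fin n) → F)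
    (x : EuclideanSpace ℝ (Fin n)) : taylorPart (ν + 1) a g x = fun t => taylorPart ν a g x t +
      (a ^ (2 * ν) * t ^ (2 * ν + 1) / ((2 * ν + 1).factorial : ℝ)) • lapPow ν g x := by
  ext t
  rw [taylorPart, sum_range_succ]
  rfl

theorem hasDerivAt_monomial_smul (c : ℝ) (k : ℕ) (v : F) (t : ℝ) :
    HasDerivAt (fun t : ℝ => (c * t ^ (k + 1) / ((k + 1).factorial : ℝ)) • v)
      ((c * t ^ k / (k.factorial : ℝ)) • v) t := by
  simp only [mul_div_assoc]
  exact ((hasDerivAt_pow_div_factorial k t).const_mul c).smul_const v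

theorem hasDerivAt_taylorPart_zero (ν : ℕ) (a : ℝ) (g : EuclideanSpace ℝ (Fin n) → F)
    (x : EuclideanSpace ℝ (Fin n)) :
    HasDerivAt (taylorPart (ν + 1) a g x) (g x) 0 := by
  induction ν with
  | zero =>
    rw [taylorPart_succ]
    refine ((hasDerivAt_const (0 : ℝ) (0 : F)).add
      (hasDerivAt_monomial_smul (a ^ (2 * 0)) (2 * 0) (lapPow 0 g x) 0)).congr_deriv ?_
    simp [lapPow_zero]
  | succ ν ih =>
    rw [taylorPart_succ]
    refine (ih.add (hasDerivAt_monomial_smul (a ^ (2 * (ν + 1))) (2 * (ν + 1))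
      (lapPow (ν + 1) g x) 0)).congr_deriv ?_
    simp

/-- Truncating the formal series solution of the wave equation leaves exactly its last monomial as
error, the term that compensates the source of the iterated means. -/
theorem deriv_deriv_taylorPart (ν : ℕ) (a : ℝ) {g : EuclideanSpace ℝ (Fin n) → F}
    (hg : ContDiff ℝ ∞ g) (x : EuclideanSpace ℝ (Fin n)) (t : ℝ) :
    deriv (deriv (taylorPart (ν + 1) a g x)) t =
      a ^ 2 • taylorPart (ν + 1) a (Laplacian.laplacian g) x t -
      (a ^ (2 * (ν + 1)) * t ^ (2 * ν + 1) / ((2 * ν + 1).factorial : ℝ)) • lapPow (ν + 1) g x := by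
  induction ν with
  | zero =>
    have h : deriv (taylorPart (0 + 1) a g x) = fun _ => g x := by
      ext t
      rw [taylorPart_succ]
      refine ((hasDerivAt_const t (0 : F)).add
        (hasDerivAt_monomial_smul (a ^ (2 * 0)) (2 * 0) (lapPow 0 g x) t)).deriv.trans ?_
      simp [lapPow_zero]
    rw [h]
    simp [taylorPart, lapPow_zero, lapPow_succ, smul_smul]
  | succ ν ih =>
    have hs : ContDiff ℝ ∞ (taylorPart (ν + 1) a g x) :=
      (smoothOp_taylorPart (ν + 1) a).contDiff_right hg x
    have hs' : ContDiff ℝ ∞ (deriv (taylorPart (ν + 1) a g x)) := (contDiff_infty_iff_deriv.1 hs).2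
    have h1 : deriv (taylorPart (ν + 1 + 1) a g x) = fun t => deriv (taylorPart (ν + 1) a g x) t +
        (a ^ (2 * (ν + 1)) * t ^ (2 * ν + 1 + 1) / ((2 * ν + 1 + 1).factorial : ℝ)) •
          lapPow (ν + 1) g x := by
      ext t
      rw [taylorPart_succ]
      exact ((hs.differentiable (by simp) t).hasDerivAt.add
        (hasDerivAt_monomial_smul (a ^ (2 * (ν + 1))) (2 * (ν + 1)) (lapPow (ν + 1) g x) t)).deriv
    rw [h1]
    refine ((hs'.differentiable (by simp) t).hasDerivAt.add
      (hasDerivAt_monomial_smul (a ^ (2 * (ν + 1))) (2 * ν + 1) (lapPow (ν + 1) g x) t)).deriv.trans ?_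
    rw [ih, taylorPart_succ (ν + 1), smul_add, smul_smul, lapPow_succ (ν + 1),
      show a ^ 2 * (a ^ (2 * (ν + 1)) * t ^ (2 * (ν + 1) + 1) / ((2 * (ν + 1) + 1).factorial : ℝ)) =
        a ^ (2 * (ν + 1 + 1)) * t ^ (2 * (ν + 1) + 1) / ((2 * (ν + 1) + 1).factorial : ℝ) by ring]
    abel

theorem waveOp_zero (ν : ℕ) (a : ℝ) (g : EuclideanSpace ℝ (Fin n) → F)
    (x : EuclideanSpace ℝ (Fin n)) : waveOp ν a g x 0 = 0 := by
  simp [waveOp, taylorPart]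

variable [CompleteSpace F]

/-- For `ν = 0` the velocity comes from the normalized mean at radius `0`. For `ν > 0` the
primitives vanish there and it comes from the linear Taylor term. -/
theorem deriv_waveOp_zero {ν : ℕ} (hn : n = 2 * ν + 3) (a : ℝ) {g : EuclideanSpace ℝ (Fin n) → F}
    (hg : ContDiff ℝ ∞ g) (x : EuclideanSpace ℝ (Fin n)) : deriv (waveOp ν a g x) 0 = g x := by
  have hs : ContDiff ℝ ∞ (weightedPrimitive^[ν] (scaledMean ν a g x)) :=
    ((smoothOp_scaledMean ν a).weightedPrimitive_iterate ν).contDiff_right hg x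
  have h1 := hasDerivAt_smul_id (hs.differentiable (by simp) 0)
  rw [zero_smul, zero_add] at h1
  cases ν with
  | zero =>
    refine (h1.add (hasDerivAt_const (0 : ℝ) (0 : F))).deriv.trans ?_
    rw [Function.iterate_zero, id, scaledMean_zero hn]
    simp [lapPow_zero]
  | succ ν =>
    refine (h1.add (hasDerivAt_taylorPart_zero ν a g x)).deriv.trans ?_
    rw [Function.iterate_succ_apply', weightedPrimitive_zero, zero_add]

theorem deriv_deriv_waveOp {ν : ℕ} (hn : n = 2 * ν + 3) (a : ℝ)
    {g : EuclideanSpace ℝ (Fin n) → F} (hg : ContDiff ℝ ∞ g) (x : EuclideanSpace ℝ (Fin n)) (t : ℝ)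
    :
    deriv (deriv (waveOp ν a g x)) t = a ^ 2 • waveOp ν a (Laplacian.laplacian g) x t := by
  have hs : ContDiff ℝ ∞ (weightedPrimitive^[ν] (scaledMean ν a g x)) :=
    ((smoothOp_scaledMean ν a).weightedPrimitive_iterate ν).contDiff_right hg x
  have ht : ContDiff ℝ ∞ (taylorPart ν a g x) := (smoothOp_taylorPart ν a).contDiff_right hg x
  have hs1 : ContDiff ℝ ∞ (fun t : ℝ => t • (weightedPrimitive^[ν] (scaledMean ν a g x)) t) :=
    contDiff_id.smul hs
  have hs' := (contDiff_infty_iff_deriv.1 hs1).2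
  have ht' := (contDiff_infty_iff_deriv.1 ht).2
  have h1 : deriv (waveOp ν a g x) = fun t =>
      deriv (fun t : ℝ => t • (weightedPrimitive^[ν] (scaledMean ν a g x)) t) t +
        deriv (taylorPart ν a g x) t := by
    ext t
    exact deriv_fun_add (hs1.differentiable (by simp) t) (ht.differentiable (by simp) t)
  rw [h1, deriv_fun_add (hs'.differentiable (by simp) t) (ht'.differentiable (by simp) t),
    deriv_deriv_smul_id hs, waveOp, smul_add]
  cases ν with
  | zero =>
    have h2 := scaledMean_epd hn a hg x t
    simp only [Function.iterate_zero, id, Nat.cast_zero, zero_add, mul_one] at h2 ⊢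
    rw [h2, smul_comm]
    have h3 : ∀ h : EuclideanSpace ℝ (Fin n) → F, taylorPart 0 a h x = fun _ => 0 := fun h => rfl
    simp [h3]
  | succ ν =>
    have h2 := weightedPrimitive_iterate_scaledMean_epd hn a hg x ν t
    rw [show 2 * (((ν + 1 : ℕ) : ℝ) - ν) = 2 by push_cast; ring] at h2
    rw [h2, deriv_deriv_taylorPart ν a hg, scaledMean_zero hn, smul_add]
    simp only [smul_smul]
    -- The source monomial equals the truncation error: `(2ν+1)! = (2ν+1)!! · 2^ν ν!`, and the
    -- factor `2(ν+1)+1` cancels in `(2ν+3)!!`.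
    have h3 : t * ((2 * ((ν + 1 : ℕ) : ℝ) + 1) / (2 ^ ν * ν.factorial) * t ^ (2 * ν) *
        ((a ^ 2) ^ (ν + 1) * ((2 * (ν + 1) + 1).doubleFactorial : ℝ)⁻¹)) =
        a ^ (2 * (ν + 1)) * t ^ (2 * ν + 1) / ((2 * ν + 1).factorial : ℝ) := by
      rw [Nat.factorial_eq_mul_doubleFactorial, Nat.doubleFactorial_two_mul,
        show 2 * (ν + 1) + 1 = 2 * ν + 1 + 2 by ring, Nat.doubleFactorial_add_two]
      have h4 : ((2 * ν + 1).doubleFactorial : ℝ) ≠ 0 := by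
        exact_mod_cast (Nat.doubleFactorial_pos _).ne'
      have h5 : (ν.factorial : ℝ) ≠ 0 := by exact_mod_cast ν.factorial_ne_zero
      push_cast
      have h6 : (2 * (ν : ℝ) + 1 + 2) ≠ 0 := by positivity
      field_simp
      ring
    rw [h3, mul_comm t (a ^ 2)]
    abel

theorem iteratedDeriv_two_mul_waveOp {ν : ℕ} (hn : n = 2 * ν + 3) (a : ℝ) (i : ℕ)
    {g : EuclideanSpace ℝ (Fin n) → F} (hg : ContDiff ℝ ∞ g) (x : EuclideanSpace ℝ (Fin n)) (t : ℝ)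
    :
    iteratedDeriv (2 * i) (waveOp ν a g x) t = (a ^ 2) ^ i • waveOp ν a (lapPow i g) x t := by
  induction i generalizing t with
  | zero => simp [lapPow_zero]
  | succ i ih =>
    rw [show 2 * (i + 1) = 2 * i + 1 + 1 by ring, iteratedDeriv_succ, iteratedDeriv_succ, funext ih]
    have h1 : deriv (fun t => (a ^ 2) ^ i • waveOp ν a (lapPow i g) x t) =
        fun t => (a ^ 2) ^ i • deriv (waveOp ν a (lapPow i g) x) t :=
      funext fun t => deriv_fun_const_smul_field _ _
    rw [h1, deriv_fun_const_smul_field, deriv_deriv_waveOp hn a (contDiff_lapPow i hg), smul_smul,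
      ← pow_succ, lapPow_succ']

theorem iteratedDeriv_two_mul_waveOp_zero {ν : ℕ} (hn : n = 2 * ν + 3) (a : ℝ) (i : ℕ)
    {g : EuclideanSpace ℝ (Fin n) → F} (hg : ContDiff ℝ ∞ g) (x : EuclideanSpace ℝ (Fin n)) :
    iteratedDeriv (2 * i) (waveOp ν a g x) 0 = 0 := by
  rw [iteratedDeriv_two_mul_waveOp hn a i hg, waveOp_zero, smul_zero]

theorem iteratedDeriv_two_mul_add_one_waveOp_zero {ν : ℕ} (hn : n = 2 * ν + 3) (a : ℝ) (i : ℕ)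
    {g : EuclideanSpace ℝ (Fin n) → F} (hg : ContDiff ℝ ∞ g) (x : EuclideanSpace ℝ (Fin n)) :
    iteratedDeriv (2 * i + 1) (waveOp ν a g x) 0 = (a ^ 2) ^ i • lapPow i g x := by
  rw [iteratedDeriv_succ, funext (iteratedDeriv_two_mul_waveOp hn a i hg x),
    deriv_fun_const_smul_field, deriv_waveOp_zero hn a (contDiff_lapPow i hg)]

end WaveEquation

/-! ### The bracket of the explicit formula is a wave -/

section Bracket

variable {n : ℕ} {F : Type*} [NormedAddCommGroup F] [NormedSpace ℝ F] [CompleteSpace F]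

theorem lapPow_sphereIntegral {ν : ℕ} (hn : n = 2 * ν + 3) {g : EuclideanSpace ℝ (Fin n) → F}
    (hg : ContDiff ℝ ∞ g) (x : EuclideanSpace ℝ (Fin n)) {ρ : ℝ} (hρ : ρ ≠ 0) :
    lapPow ν (fun y => (sphereNorm n ν ρ)⁻¹ • sphereIntegral g y ρ) x =
      (2 * (2 * Real.pi) ^ (ν + 1))⁻¹ • unitSphereIntegral (lapPow ν g) x ρ := by
  -- The exponent `n - 1` is even because `n` is odd, so signed radii do no harm.
  have habs : |ρ| ^ (n - 1) = ρ ^ (n - 1) := by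
    rw [hn, show 2 * ν + 3 - 1 = 2 * (ν + 1) by omega, pow_mul, pow_mul, sq_abs]
  have heq : ∀ y, unitSphereIntegral g y |ρ| = unitSphereIntegral g y ρ := by
    intro y
    rcases abs_choice ρ with h | h <;> rw [h]
    rw [unitSphereIntegral_neg]
  have h1 : (fun y => (sphereNorm n ν ρ)⁻¹ • sphereIntegral g y ρ) =
      fun y => (2 * (2 * Real.pi) ^ (ν + 1))⁻¹ • unitSphereIntegral g y ρ := by
    ext y
    rw [← heq, unitSphereIntegral, sphereIntegral, sphereNorm, habs, smul_smul, mul_inv, mul_assoc,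
      inv_mul_cancel₀ (pow_ne_zero _ hρ), mul_one]
  rw [h1, lapPow_const_smul ν _ (contDiff_slice (smoothOp_unitSphereIntegral.contDiff hg) ρ),
    smoothOp_unitSphereIntegral.lapPow_comm ν hg]

theorem bracket_eq_waveOp {ν : ℕ} (hn : n = 2 * ν + 3) {a : ℝ} (ha : a ≠ 0)
    {g : EuclideanSpace ℝ (Fin n) → F} (hg : ContDiff ℝ ∞ g) (x : EuclideanSpace ℝ (Fin n)) (t : ℝ)
    :
    bracket ν a g x t = waveOp ν a g x t := by
  set M : ℝ → F := fun s => (a ^ 2) ^ ν •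
    lapPow ν (fun y => (sphereNorm n ν (a * s))⁻¹ • sphereIntegral g y (a * s)) x with hM
  have hMN : ∀ s, s ≠ 0 → M s = scaledMean ν a g x s := fun s hs => by
    rw [hM, scaledMean, mul_smul]
    exact congrArg _ (lapPow_sphereIntegral hn hg x (mul_ne_zero ha hs))
  -- At `s = 0` the normalization is zero and its inverse is `0` by convention, so `M` may differ
  -- from the smooth mean there. The factor `s`, in the weighted primitive or in front, hides this
  -- one point.
  have hsM : ∀ s, s • M s = s • scaledMean ν a g x s := fun s => by
    rcases eq_or_ne s 0 with rfl | hs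
    · simp
    · rw [hMN s hs]
  have h1 : t • (weightedPrimitive^[ν] M) t =
      t • (weightedPrimitive^[ν] (scaledMean ν a g x)) t := by
    cases ν with
    | zero => exact hsM t
    | succ ν =>
      have h2 : weightedPrimitive M = weightedPrimitive (scaledMean (ν + 1) a g x) := by
        ext t
        simp only [weightedPrimitive, hsM]
      rw [Function.iterate_succ_apply, Function.iterate_succ_apply, h2]
  rw [bracket, waveOp, taylorPart, ← h1]

end Bracket

/-! ### Lagrange identities and the leading coefficient -/

section Lagrange

variable {m : ℕ} {y : Fin m → ℝ}

/-- The sum is the coefficient of `X^{m-1}` in the Lagrange interpolation of `X^i` at `m` nodes,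
which reproduces `X^i` itself. -/
theorem sum_pow_div_prod_sub_eq_zero (hy : Function.Injective y) {i : ℕ} (hi : i + 1 < m) :
    ∑ j, y j ^ i / ∏ k ∈ univ.erase j, (y j - y k) = 0 := by
  have h := Lagrange.coeff_eq_sum (s := univ) (v := y) hy.injOn
    (P := (Polynomial.X : Polynomial ℝ) ^ i) (by
      rw [Polynomial.degree_X_pow, card_univ, Fintype.card_fin]
      exact_mod_cast (by omega : i < m))
  rw [card_univ, Fintype.card_fin, Polynomial.coeff_X_pow, if_neg (by omega)] at h
  simpa using h.symm

theorem sum_pow_div_prod_sub_eq_one (hy : Function.Injective y) (hm : 0 < m) :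
    ∑ j, y j ^ (m - 1) / ∏ k ∈ univ.erase j, (y j - y k) = 1 := by
  have h := Lagrange.coeff_eq_sum (s := univ) (v := y) hy.injOn
    (P := (Polynomial.X : Polynomial ℝ) ^ (m - 1)) (by
      rw [Polynomial.degree_X_pow, card_univ, Fintype.card_fin]
      exact_mod_cast (by omega : m - 1 < m))
  rw [card_univ, Fintype.card_fin, Polynomial.coeff_X_pow, if_pos rfl] at h
  simpa using h.symm

theorem leadingCoeff_eq_one {a : Fin m → ℝ} {b : ℕ → ℝ}
    (hb : ∀ x : ℝ, ∑ k ∈ range (m + 1), b (2 * k) * x ^ (2 * k) = ∏ i, (x ^ 2 - a i ^ 2)) :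
    b (2 * m) = 1 := by
  set P : Polynomial ℝ := ∑ k ∈ range (m + 1), Polynomial.C (b (2 * k)) * Polynomial.X ^ k with hP
  set Q : Polynomial ℝ := ∏ i, (Polynomial.X - Polynomial.C (a i ^ 2)) with hQ
  -- In the variable `y = x²` the hypothesis covers only `y ≥ 0`, which is still infinitely many
  -- points.
  have hPQ : P = Q := by
    refine Polynomial.eq_of_infinite_eval_eq P Q (Set.Infinite.mono ?_ (Set.Ici_infinite (0 : ℝ)))
    intro y hy
    have h := hb (Real.sqrt y)
    simp only [pow_mul, Real.sq_sqrt (Set.mem_Ici.1 hy)] at h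
    simpa [hP, hQ, Polynomial.eval_finsetSum, Polynomial.eval_prod] using h
  have h1 : P.coeff m = b (2 * m) := by
    simp [hP, Polynomial.coeff_C_mul, Polynomial.coeff_X_pow]
  have h2 : Q.Monic := Polynomial.monic_prod_of_monic _ _ fun i _ => Polynomial.monic_X_sub_C _
  have h3 : Q.natDegree = m := by
    rw [hQ, Polynomial.natDegree_prod_of_monic _ _ fun i _ => Polynomial.monic_X_sub_C _]
    simp only [Polynomial.natDegree_X_sub_C]
    simp
  rw [← h1, hPQ, ← h3]
  exact h2

end Lagrange

/-! ### Repeated integration and vanishing from Taylor data -/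

section Vanishing

variable {F : Type*} [NormedAddCommGroup F] [NormedSpace ℝ F]

theorem eq_zero_of_iteratedDeriv_eq_zero {V : ℝ → F} (hV : ContDiff ℝ ∞ V) (k : ℕ)
    (h : ∀ t, iteratedDeriv k V t = 0) (h0 : ∀ q < k, iteratedDeriv q V 0 = 0) (t : ℝ) :
    V t = 0 := by
  induction k generalizing t with
  | zero => simpa using h t
  | succ k ih =>
    refine ih (fun t => ?_) (fun q hq => h0 q (by omega)) t
    have hd : Differentiable ℝ (iteratedDeriv k V) :=
      hV.differentiable_iteratedDeriv k
        (by exact_mod_cast WithTop.coe_lt_coe.2 (ENat.natCast_lt_top k))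
    rw [is_const_of_deriv_eq_zero hd (fun s => by rw [← iteratedDeriv_succ]; exact h s) t 0]
    exact h0 k (by omega)

variable [CompleteSpace F]

/-- The kernel of positive degree vanishes at `τ = t`, so there is no boundary term: this is
Cauchy's formula for repeated integration. -/
theorem deriv_integral_pow_smul {h : ℝ → F} (hh : ContDiff ℝ ∞ h) (N : ℕ) :
    deriv (fun t => ∫ τ in (0 : ℝ)..t, ((t - τ) ^ (N + 1) / ((N + 1).factorial : ℝ)) • h τ) =
      fun t => ∫ τ in (0 : ℝ)..t, ((t - τ) ^ N / (N.factorial : ℝ)) • h τ := by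
  ext t
  have hH : ContDiff ℝ ∞ (fun p : ℝ × ℝ => (p.2 ^ (N + 1) / ((N + 1).factorial : ℝ)) • h p.1) := by
    fun_prop
  refine (deriv_integral_conv hH t).trans ?_
  simp only [ne_eq, Nat.add_eq_zero_iff, one_ne_zero, and_false, not_false_eq_true, zero_pow,
    zero_div, zero_smul, zero_add]
  refine intervalIntegral.integral_congr fun τ _ => ?_
  exact ((hasDerivAt_pow_div_factorial N (t - τ)).smul_const (h τ)).deriv

theorem deriv_integral_pow_zero_smul {h : ℝ → F} (hh : ContDiff ℝ ∞ h) :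
    deriv (fun t => ∫ τ in (0 : ℝ)..t, ((t - τ) ^ 0 / (Nat.factorial 0 : ℝ)) • h τ) = h := by
  ext t
  simpa using (intervalIntegral.integral_hasDerivAt_right (hh.continuous.intervalIntegrable 0 t)
    hh.continuous.stronglyMeasurable.stronglyMeasurableAtFilter hh.continuous.continuousAt).deriv

theorem iteratedDeriv_integral_pow_smul {h : ℝ → F} (hh : ContDiff ℝ ∞ h) (N r : ℕ) :
    iteratedDeriv r
      (fun t => ∫ τ in (0 : ℝ)..t, ((t - τ) ^ (N + r) / ((N + r).factorial : ℝ)) • h τ) =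
      fun t => ∫ τ in (0 : ℝ)..t, ((t - τ) ^ N / (N.factorial : ℝ)) • h τ := by
  induction r with
  | zero => simp
  | succ r ih => rw [iteratedDeriv_succ', ← add_assoc, deriv_integral_pow_smul hh, ih]

theorem iteratedDeriv_integral_pow_smul_top {h : ℝ → F} (hh : ContDiff ℝ ∞ h) (N r : ℕ) :
    iteratedDeriv (N + 1 + r)
      (fun t => ∫ τ in (0 : ℝ)..t, ((t - τ) ^ N / (N.factorial : ℝ)) • h τ) =
      iteratedDeriv r h := by
  have h1 := iteratedDeriv_integral_pow_smul hh 0 N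
  rw [zero_add] at h1
  have h2 : iteratedDeriv (N + 1)
      (fun t => ∫ τ in (0 : ℝ)..t, ((t - τ) ^ N / (N.factorial : ℝ)) • h τ) = h := by
    rw [iteratedDeriv_succ, h1, deriv_integral_pow_zero_smul hh]
  rw [add_comm, iteratedDeriv_eq_iterate, Function.iterate_add_apply, ← iteratedDeriv_eq_iterate,
    ← iteratedDeriv_eq_iterate, h2]

end Vanishing

/-! ### The concrete propagator -/

section Propagator

variable {n ν m : ℕ} {F : Type*} [NormedAddCommGroup F] [NormedSpace ℝ F] [CompleteSpace F]
  {a : Fin m → ℝ}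

/-- The coefficients of the brackets in `bracketSum`. -/
def bracketCoeff (a : Fin m → ℝ) (j : Fin m) : ℝ :=
  a j ^ (2 * m - 2) / ∏ i ∈ univ.erase j, (a j ^ 2 - a i ^ 2)

theorem bracketSum_eq (hn : n = 2 * ν + 3) (hm : 1 < m) {g : EuclideanSpace ℝ (Fin n) → F}
    (hg : ContDiff ℝ ∞ g) (x : EuclideanSpace ℝ (Fin n)) (t : ℝ) :
    bracketSum m ν a g x t = ∑ j, bracketCoeff a j • waveOp ν (a j) g x t := by
  refine sum_congr rfl fun j _ => ?_
  -- For `a j = 0` the bracket need not be the wave, but its coefficient vanishes since `2m - 2 >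
  -- 0`.
  rcases eq_or_ne (a j) 0 with h | h
  · rw [bracketCoeff, h, zero_pow (by omega), zero_div, zero_smul, zero_smul]
  · rw [bracket_eq_waveOp hn h hg, bracketCoeff]

theorem smoothOp_bracketSum (hn : n = 2 * ν + 3) (hm : 1 < m) :
    SmoothOp (bracketSum m ν a : (EuclideanSpace ℝ (Fin n) → F) → _) :=
  (SmoothOp.sum univ fun j _ => (smoothOp_waveOp ν (a j)).const_smul (bracketCoeff a j)).congr
    fun _ hg x t => bracketSum_eq hn hm hg x t

theorem iteratedDeriv_bracketSum (hn : n = 2 * ν + 3) (hm : 1 < m)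
    {g : EuclideanSpace ℝ (Fin n) → F} (hg : ContDiff ℝ ∞ g) (x : EuclideanSpace ℝ (Fin n))
    (k : ℕ) (t : ℝ) : iteratedDeriv k (bracketSum m ν a g x) t =
      ∑ j, bracketCoeff a j • iteratedDeriv k (waveOp ν (a j) g x) t := by
  rw [funext (bracketSum_eq hn hm hg x), iteratedDeriv_fun_sum fun j _ => (contDiff_infty.1
    (((smoothOp_waveOp ν (a j)).contDiff_right hg x).const_smul (bracketCoeff a j)) k).contDiffAt]
  exact sum_congr rfl fun j _ => iteratedDeriv_fun_const_smul_field _ _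

/-- The operator applied to the data in `explicitSolution`. -/
def propagator (m ν : ℕ) (a : Fin m → ℝ) (g : EuclideanSpace ℝ (Fin n) → F)
    (x : EuclideanSpace ℝ (Fin n)) (t : ℝ) : F :=
  ∫ τ in (0 : ℝ)..t, ((t - τ) ^ (2 * m - 3) / ((2 * m - 3).factorial : ℝ)) •
    bracketSum m ν a g x τ

theorem smoothOp_propagator (hn : n = 2 * ν + 3) (hm : 1 < m) :
    SmoothOp (propagator m ν a : (EuclideanSpace ℝ (Fin n) → F) → _) :=
  (smoothOp_bracketSum hn hm).conv
    (k := fun t => t ^ (2 * m - 3) / ((2 * m - 3).factorial : ℝ)) (by fun_prop)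

theorem iteratedDeriv_propagator_of_lt (hn : n = 2 * ν + 3) (hm : 1 < m)
    {g : EuclideanSpace ℝ (Fin n) → F} (hg : ContDiff ℝ ∞ g) (x : EuclideanSpace ℝ (Fin n))
    {r : ℕ} (hr : r < 2 * m - 2) : iteratedDeriv r (propagator m ν a g x) 0 = 0 := by
  have h := iteratedDeriv_integral_pow_smul
    ((smoothOp_bracketSum (ν := ν) (a := a) hn hm).contDiff_right hg x) (2 * m - 3 - r) r
  rw [Nat.sub_add_cancel (by omega)] at h
  exact (congrFun h 0).trans intervalIntegral.integral_same

theorem iteratedDeriv_propagator_add (hn : n = 2 * ν + 3) (hm : 1 < m)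
    {g : EuclideanSpace ℝ (Fin n) → F} (hg : ContDiff ℝ ∞ g) (x : EuclideanSpace ℝ (Fin n))
    (r : ℕ) : iteratedDeriv (2 * m - 2 + r) (propagator m ν a g x) =
      iteratedDeriv r (bracketSum m ν a g x) := by
  rw [show 2 * m - 2 = 2 * m - 3 + 1 by omega]
  exact iteratedDeriv_integral_pow_smul_top
    ((smoothOp_bracketSum (ν := ν) (a := a) hn hm).contDiff_right hg x) (2 * m - 3) r

theorem iteratedDeriv_two_mul_propagator_zero (hn : n = 2 * ν + 3) (hm : 1 < m)
    {g : EuclideanSpace ℝ (Fin n) → F} (hg : ContDiff ℝ ∞ g) (x : EuclideanSpace ℝ (Fin n))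
    (i : ℕ) : iteratedDeriv (2 * i) (propagator m ν a g x) 0 = 0 := by
  rcases lt_or_ge (2 * i) (2 * m - 2) with h | h
  · exact iteratedDeriv_propagator_of_lt hn hm hg x h
  · obtain ⟨l, rfl⟩ : ∃ l, i = m - 1 + l := ⟨i - (m - 1), by omega⟩
    rw [show 2 * (m - 1 + l) = 2 * m - 2 + 2 * l by omega, iteratedDeriv_propagator_add hn hm hg,
      iteratedDeriv_bracketSum hn hm hg]
    exact sum_eq_zero fun j _ => by rw [iteratedDeriv_two_mul_waveOp_zero hn _ _ hg, smul_zero]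

/-- One formula covers all odd orders. For `i < m - 1` the subtraction is truncated, but the
Lagrange sum in front is zero. -/
theorem iteratedDeriv_two_mul_add_one_propagator_zero (hn : n = 2 * ν + 3) (hm : 1 < m)
    (ha : Function.Injective fun j => a j ^ 2)
    {g : EuclideanSpace ℝ (Fin n) → F} (hg : ContDiff ℝ ∞ g) (x : EuclideanSpace ℝ (Fin n))
    (i : ℕ) : iteratedDeriv (2 * i + 1) (propagator m ν a g x) 0 =
      (∑ j, (a j ^ 2) ^ i / ∏ k ∈ univ.erase j, (a j ^ 2 - a k ^ 2)) •
        lapPow (i - (m - 1)) g x := by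
  rcases lt_or_ge (i + 1) m with h | h
  · rw [iteratedDeriv_propagator_of_lt hn hm hg x (by omega), sum_pow_div_prod_sub_eq_zero ha h,
      zero_smul]
  · obtain ⟨l, rfl⟩ : ∃ l, i = m - 1 + l := ⟨i - (m - 1), by omega⟩
    rw [show 2 * (m - 1 + l) + 1 = 2 * m - 2 + (2 * l + 1) by omega,
      iteratedDeriv_propagator_add hn hm hg, iteratedDeriv_bracketSum hn hm hg, sum_smul,
      Nat.add_sub_cancel_left]
    refine sum_congr rfl fun j _ => ?_
    rw [iteratedDeriv_two_mul_add_one_waveOp_zero hn _ _ hg, smul_smul, bracketCoeff, pow_add,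
      show 2 * m - 2 = 2 * (m - 1) by omega, pow_mul (a j) 2 (m - 1)]
    congr 1
    ring

theorem cauchyOp_waveOp (hn : n = 2 * ν + 3) {b : ℕ → ℝ}
    (hb : ∀ x : ℝ, ∑ k ∈ range (m + 1), b (2 * k) * x ^ (2 * k) = ∏ i, (x ^ 2 - a i ^ 2))
    (j : Fin m) {g : EuclideanSpace ℝ (Fin n) → F} (hg : ContDiff ℝ ∞ g)
    (x : EuclideanSpace ℝ (Fin n)) (t : ℝ) : cauchyOp m b (waveOp ν (a j) g) x t = 0 := by
  rw [cauchyOp_smoothOp m b (smoothOp_waveOp ν (a j)) hg]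
  have h : ∀ k ∈ range (m + 1),
      b (2 * k) • iteratedDeriv (2 * k) (waveOp ν (a j) (lapPow (m - k) g) x) t =
        (b (2 * k) * a j ^ (2 * k)) • waveOp ν (a j) (lapPow m g) x t := fun k hk => by
    rw [mem_range] at hk
    rw [iteratedDeriv_two_mul_waveOp hn _ _ (contDiff_lapPow _ hg), smul_smul, ← pow_mul,
      ← lapPow_add, Nat.add_sub_cancel' (by omega)]
  rw [sum_congr rfl h, ← sum_smul, hb, prod_eq_zero (mem_univ j) (sub_self _), zero_smul]

theorem cauchyOp_bracketSum (hn : n = 2 * ν + 3) (hm : 1 < m) {b : ℕ → ℝ}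
    (hb : ∀ x : ℝ, ∑ k ∈ range (m + 1), b (2 * k) * x ^ (2 * k) = ∏ i, (x ^ 2 - a i ^ 2))
    {g : EuclideanSpace ℝ (Fin n) → F} (hg : ContDiff ℝ ∞ g)
    (x : EuclideanSpace ℝ (Fin n)) (t : ℝ) : cauchyOp m b (bracketSum m ν a g) x t = 0 := by
  have h : bracketSum m ν a g = fun x t => ∑ j, bracketCoeff a j • waveOp ν (a j) g x t := by
    ext x t
    exact bracketSum_eq hn hm hg x t
  rw [h, cauchyOp_sum m b univ (u := fun j x t => bracketCoeff a j • waveOp ν (a j) g x t)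
    fun j _ => ((smoothOp_waveOp ν (a j)).contDiff hg).const_smul _]
  refine sum_eq_zero fun j _ => ?_
  rw [cauchyOp_const_smul m b _ ((smoothOp_waveOp ν (a j)).contDiff hg),
    cauchyOp_waveOp hn hb j hg, smul_zero]

theorem iteratedDeriv_cauchyOp_propagator (hn : n = 2 * ν + 3) (hm : 1 < m) (b : ℕ → ℝ)
    {g : EuclideanSpace ℝ (Fin n) → F} (hg : ContDiff ℝ ∞ g)
    (x : EuclideanSpace ℝ (Fin n)) (q : ℕ) (t : ℝ) :
    iteratedDeriv q (cauchyOp m b (propagator m ν a g) x) t = ∑ k ∈ range (m + 1),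
      b (2 * k) • iteratedDeriv (2 * k + q) (propagator m ν a (lapPow (m - k) g) x) t := by
  have hW := smoothOp_propagator (F := F) (a := a) hn hm
  rw [← cauchyOp_iteratedDeriv m b q (hW.contDiff hg),
    cauchyOp_smoothOp m b (hW.iteratedDeriv q) hg]
  simp only [iteratedDeriv_eq_iterate, ← Function.iterate_add_apply]

/-- `P W g` is killed by `∂_t^{2m-2}`, since this derivative turns `W` into the bracket sum. It
remains to check that its derivatives of lower order vanish at `0`. -/
theorem cauchyOp_propagator (hn : n = 2 * ν + 3) (hm : 1 < m)
    (ha : Function.Injective fun j => a j ^ 2) {b : ℕ → ℝ}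
    (hb : ∀ x : ℝ, ∑ k ∈ range (m + 1), b (2 * k) * x ^ (2 * k) = ∏ i, (x ^ 2 - a i ^ 2))
    {g : EuclideanSpace ℝ (Fin n) → F} (hg : ContDiff ℝ ∞ g)
    (x : EuclideanSpace ℝ (Fin n)) (t : ℝ) : cauchyOp m b (propagator m ν a g) x t = 0 := by
  have hW := smoothOp_propagator (F := F) (a := a) hn hm
  have hS := smoothOp_bracketSum (F := F) (a := a) hn hm
  have hV : ContDiff ℝ ∞ (cauchyOp m b (propagator m ν a g) x) :=
    ContDiff.sum fun k _ => (contDiff_slice_right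
      (G := fun x t => lapPow (m - k) (fun y => iteratedDeriv (2 * k) (propagator m ν a g y) t) x)
      (contDiff_lapPow_uncurry _ (contDiff_iteratedDeriv_uncurry (hW.contDiff hg) _))
        x).const_smul _
  refine eq_zero_of_iteratedDeriv_eq_zero hV (2 * m - 2) (fun t => ?_) (fun q hq => ?_) t
  · rw [← cauchyOp_bracketSum hn hm hb hg x t, iteratedDeriv_cauchyOp_propagator hn hm b hg,
      cauchyOp_smoothOp m b hS hg]
    refine sum_congr rfl fun k _ => ?_
    rw [add_comm, iteratedDeriv_propagator_add hn hm (contDiff_lapPow _ hg)]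
  · rw [iteratedDeriv_cauchyOp_propagator hn hm b hg]
    rcases Nat.even_or_odd' q with ⟨p, rfl | rfl⟩
    · refine sum_eq_zero fun k _ => ?_
      rw [← mul_add, iteratedDeriv_two_mul_propagator_zero hn hm (contDiff_lapPow _ hg), smul_zero]
    -- For `q = 2p + 1` every nonzero term is a multiple of the same `Δ^{p+1} g`, so only a scalar
    -- sum has to vanish.
    · have h : ∀ k ∈ range (m + 1), b (2 * k) •
          iteratedDeriv (2 * k + (2 * p + 1)) (propagator m ν a (lapPow (m - k) g) x) 0 =
          (b (2 * k) * ∑ j, (a j ^ 2) ^ (k + p) / ∏ k ∈ univ.erase j, (a j ^ 2 - a k ^ 2)) •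
            lapPow (p + 1) g x := fun k hk => by
        rw [mem_range] at hk
        rw [← add_assoc, ← mul_add,
          iteratedDeriv_two_mul_add_one_propagator_zero hn hm ha (contDiff_lapPow _ hg), smul_smul]
        rcases lt_or_ge (k + p + 1) m with h | h
        · rw [sum_pow_div_prod_sub_eq_zero ha h, mul_zero, zero_smul, zero_smul]
        · rw [← lapPow_add, show k + p - (m - 1) + (m - k) = p + 1 by omega]
      rw [sum_congr rfl h, ← sum_smul]
      -- Summing over `k` first produces, for each `j`, the factor `∑ b_{2k} a_j^{2k} = 0`.
      have h0 : ∑ k ∈ range (m + 1), b (2 * k) *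
          ∑ j, (a j ^ 2) ^ (k + p) / ∏ k ∈ univ.erase j, (a j ^ 2 - a k ^ 2) = 0 := by
        simp only [mul_sum]
        rw [sum_comm]
        refine sum_eq_zero fun j _ => ?_
        have h1 := hb (a j)
        rw [prod_eq_zero (mem_univ j) (sub_self _)] at h1
        have h2 : ∀ k ∈ range (m + 1), b (2 * k) *
            ((a j ^ 2) ^ (k + p) / ∏ k ∈ univ.erase j, (a j ^ 2 - a k ^ 2)) =
            b (2 * k) * a j ^ (2 * k) *
              ((a j ^ 2) ^ p / ∏ k ∈ univ.erase j, (a j ^ 2 - a k ^ 2)) := fun k _ => by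
          rw [pow_add, ← pow_mul (a j) 2 k]
          ring
        rw [sum_congr rfl h2, ← sum_mul, h1, zero_mul]
      rw [h0, zero_smul]

theorem isPropagator_propagator (hn : n = 2 * ν + 3) (hm : 1 < m)
    (ha : Function.Injective fun j => a j ^ 2) {b : ℕ → ℝ}
    (hb : ∀ x : ℝ, ∑ k ∈ range (m + 1), b (2 * k) * x ^ (2 * k) = ∏ i, (x ^ 2 - a i ^ 2)) :
    IsPropagator m b (propagator m ν a : (EuclideanSpace ℝ (Fin n) → F) → _) where
  smoothOp := smoothOp_propagator hn hm
  init_zero g hg r hr x := by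
    rcases lt_or_ge r (2 * m - 2) with h | h
    · exact iteratedDeriv_propagator_of_lt hn hm hg x h
    · rw [show r = 2 * (m - 1) by omega, iteratedDeriv_two_mul_propagator_zero hn hm hg]
  init_last g hg x := by
    rw [show 2 * m - 1 = 2 * (m - 1) + 1 by omega,
      iteratedDeriv_two_mul_add_one_propagator_zero hn hm ha hg,
      sum_pow_div_prod_sub_eq_one ha (by omega), one_smul, Nat.sub_self, lapPow_zero]
  eqn g hg x t := cauchyOp_propagator hn hm ha hb hg x t

/-- The double integral is by definition Duhamel's integral of the propagator; only the data term
needs an argument. -/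
theorem explicitSolution_eq (hn : n = 2 * ν + 3) (hm : 1 < m) (b : ℕ → ℝ)
    (f : EuclideanSpace ℝ (Fin n) → ℝ → F) {phi : ℕ → EuclideanSpace ℝ (Fin n) → F}
    (hphi : ∀ r < 2 * m, ContDiff ℝ ∞ (phi r)) :
    explicitSolution m ν a b f phi = fun x t =>
      duhamel (propagator m ν a) f x t + dataPart m b (propagator m ν a) phi x t := by
  ext x t
  rw [← sum_smul_lapPow_eq_dataPart m b (smoothOp_propagator hn hm) hphi]
  rfl

end Propagator

end HigherOrderCauchy

end

/-! ### Existence, uniqueness and the explicit formula -/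

theorem theorem3 {𝕜 : Type*} [RCLike 𝕜] (n ν m : ℕ) (hn : n = 2 * ν + 3) (hm : 1 < m)
    (a : Fin m → ℝ) (ha : ∀ i j, i ≠ j → a i ^ 2 ≠ a j ^ 2)
    (b : ℕ → ℝ)
    (hb : ∀ x : ℝ, ∑ k ∈ Finset.range (m + 1), b (2 * k) * x ^ (2 * k) = ∏ i, (x ^ 2 - a i ^ 2))
    (f : EuclideanSpace ℝ (Fin n) → ℝ → 𝕜)
    (hf : ContDiff ℝ ∞ (fun p : EuclideanSpace ℝ (Fin n) × ℝ => f p.1 p.2))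
    (phi : ℕ → EuclideanSpace ℝ (Fin n) → 𝕜)
    (hphi : ∀ r < 2 * m, ContDiff ℝ ∞ (phi r)) :
    HigherOrderCauchy.IsCauchySolution m b f phi
        (HigherOrderCauchy.explicitSolution m ν a b f phi) ∧
      ∀ u : EuclideanSpace ℝ (Fin n) → ℝ → 𝕜,
        HigherOrderCauchy.IsCauchySolution m b f phi u →
          u = HigherOrderCauchy.explicitSolution m ν a b f phi := by
  have ha' : Function.Injective fun j => a j ^ 2 := fun i j h =>
    by_contra fun hij => ha i j hij h
  have hW := HigherOrderCauchy.isPropagator_propagator (F := 𝕜) hn hm ha' hb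
  have hb1 := HigherOrderCauchy.leadingCoeff_eq_one hb
  rw [HigherOrderCauchy.explicitSolution_eq hn hm b f hphi]
  refine ⟨hW.isCauchySolution (by omega) hb1 hf hphi, fun u hu => ?_⟩
  ext x t
  exact hW.eq_of_isCauchySolution (by omega) hb1 hu x t
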